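/- Let $G$ be a locally compact, second countable Hausdorff group with identity $1$ and left Haar measure $\lambda$. Let $\mathbb M$ be the space of closed discrete subsets of $G$, with the Borel structure generated by the point counts $\omega\mapsto|\omega\cap U|$ ($U\subseteq G$ Borel) and with the left translation action of $G$. Let $\mu$ be a $G$-invariant Borel probability measure on $\mathbb M$ (the law of an invariant point process) whose intensity $\operatorname{int}(\mu)=\lambda(U)^{-1}\,\mathbb E_\mu|\omega\cap U|$ is positive and finite, where $U$ is a Borel set with $0<\lambda(U)<\infty$. Put $$\mathbb M_0=\{\omega\in\mathbb M: 1\in\omega\},\qquad \overrightarrow{\mathbb M}=\{(\omega,g)\in\mathbb M_0\times G: g\in\omega\}.$$ These are the units and the arrows of the rerooting groupoid, with source $s(\omega,g)=\omega$, target $t(\omega,g)=g^{-1}\omega$ and product $(\omega,g)\cdot(g^{-1}\omega,h)=(\omega,gh)$. The Palm measure of $\mu$ is $$\mu_0(A)=\frac{1}{\operatorname{int}(\mu)\,\lambda(U)}\ \mathbb E_\mu\big[\#\{g\in \omega\cap U: g^{-1}\omega\in A\}\big]\qquad(A\subseteq\mathbb M_0\text{ Borel}),$$ and it induces on $\overrightarrow{\mathbb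 M}$ the measures $\mu^s(S)=\int|s^{-1}(\omega)\cap S|\,d\mu_0(\omega)$ and $\mu^t(S)=\int|t^{-1}(\omega)\cap S|\,d\mu_0(\omega)$. Then $\operatorname{int}(\mu)$ and $\mu_0$ do not depend on $U$, and $\mu_0$ is a probability measure. The rerooting groupoid is an $r$-discrete Borel groupoid: units and arrows are standard Borel spaces, the structure maps are Borel, and the fibres of $s$ and $t$ are countable. If $G$ is unimodular, then $\mu^s=\mu^t$, that is, the groupoid with $\mu_0$ (the Palm groupoid of $\mu$) is probability measure preserving. Let moreover $\Xi$ be a nonempty complete separable metric space (only its topology matters). Call a Borel map from $\mathbb M$ to a Borel $G$-space a factor map of $\mu$ if it is equivariant on some $G$-invariant Borel set of full $\mu$-measure; outside that set its values are irrelevant, and the further conditions below are also required only on such a set. The following maps are well defined and induce mutually inverse bijections between classes of objects modulo almost everywhere equality. (1) Factor thinnings of $\mu$ (factor maps $\theta:\mathbb M\to\mathbb M$ with $\theta(\omega)\subseteq\omega$), modulo $\mu$, and Borel sets $A\subseteq\mathbb M_0$, modulo $\mu_0$: $$A_\theta=\{\omega\in\mathbb M_0: 1\in\theta(\omega)\},\qquad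 \theta^A(\omega)=\{g\in\omega: g^{-1}\omega\in A\}.$$ (2) Factor $\Xi$-markings of $\mu$ (factor maps $\mathscr C$ into the space of closed discrete subsets of $G\times\Xi$ with at most one mark at each point, such that the underlying set of $\mathscr C(\omega)$ is $\omega$), modulo $\mu$, and Borel maps $P:\mathbb M_0\to\Xi$, modulo $\mu_0$: $$P_{\mathscr C}(\omega)=\text{the mark of }1\text{ in }\mathscr C(\omega),\qquad \mathscr C^P(\omega)=\{(g,P(g^{-1}\omega)): g\in\omega\}.$$ (3) Factor graphs of $\mu$ (factor maps $\mathscr G$ into the space of directed graphs in $G$, that is, pairs of a vertex set $V\in\mathbb M$ and a closed discrete edge set $E\subseteq V\times V$, such that the vertex set of $\mathscr G(\omega)$ is $\omega$), modulo $\mu$, and Borel sets $\mathscr A\subseteq\overrightarrow{\mathbb M}$, modulo $\mu^s$: $$\mathscr A_{\mathscr G}=\{(\omega,g): (1,g)\text{ is an edge of }\mathscr G(\omega)\},\qquad \mathscr G^{\mathscr A}(\omega)=\{(g,h)\in\omega\times\omega:(g^{-1}\omega,g^{-1}h)\in\mathscr A\}.$$ -/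

import Mathlib

open MeasureTheory Set ProbabilityTheory Function
open scoped ENNReal Pointwise

namespace PointProcess

noncomputable section

/-! ### Configuration spaces -/

/-- The configuration space `𝕄(Z)`: the closed and discrete (that is, locally finite) subsets of
`Z`. -/
@[ext]
structure Config (Z : Type*) [TopologicalSpace Z] where
  carrier : Set Z
  isClosed : IsClosed carrier
  isDiscrete : IsDiscrete carrier

namespace Config

variable {Z W : Type*} [TopologicalSpace Z] [TopologicalSpace W]

instance : SetLike (Config Z) Z where
  coe := Config.carrier
  coe_injective _ _ h := Config.ext h

/-- The number of points of `ω` in `U`. -/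
def count (U : Set Z) (ω : Config Z) : ℕ∞ := ((ω : Set Z) ∩ U).encard

/-- The Borel structure of `𝕄(Z)`: the smallest one for which the point counting functions of all
Borel sets are measurable. -/
instance [MeasurableSpace Z] : MeasurableSpace (Config Z) :=
  ⨆ (U : Set Z) (_ : MeasurableSet U), MeasurableSpace.comap (count U) ⊤

/-- The image of a configuration under a homeomorphism. -/
def map (e : Z ≃ₜ W) (ω : Config Z) : Config W where
  carrier := e '' (ω : Set Z)
  isClosed := e.isClosedMap _ ω.isClosed
  isDiscrete := ω.isDiscrete.image e.isInducing

/-- A subset of a configuration is a configuration. -/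
def sub (ω : Config Z) (s : Set Z) (h : s ⊆ (ω : Set Z)) : Config Z where
  carrier := s
  isClosed := isClosed_of_subset_discrete_closed h ω.isDiscrete ω.isClosed
  isDiscrete := ω.isDiscrete.mono h

end Config

section Group

variable {G : Type*} [Group G] [TopologicalSpace G] [IsTopologicalGroup G]

/-- `G` acts on `𝕄(G)` by left translation. -/
instance : SMul G (Config G) where
  smul g ω := ω.map (Homeomorph.mulLeft g)

theorem Config.coe_smul (g : G) (ω : Config G) : ((g • ω : Config G) : Set G) = g • (ω : Set G) :=
  rfl

theorem Config.mem_smul {g x : G} {ω : Config G} : x ∈ g • ω ↔ g⁻¹ * x ∈ ω := by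
  change x ∈ ((g • ω : Config G) : Set G) ↔ _
  rw [Config.coe_smul, Set.mem_smul_set_iff_inv_smul_mem]
  rfl

instance : MulAction G (Config G) where
  one_smul ω := SetLike.coe_injective (by rw [Config.coe_smul, one_smul])
  mul_smul g h ω := SetLike.coe_injective (by simp only [Config.coe_smul, mul_smul])

/-! ### Marked configurations and graphs -/

/-- The `Ξ`-marked configuration space of `G`: the closed and discrete subsets of `G × Ξ` in which
every point carries at most one mark. -/
def MarkedConfig (G Ξ : Type*) [TopologicalSpace G] [TopologicalSpace Ξ] : Type _ :=
  {ω : Config (G × Ξ) // ∀ g ξ ξ', (g, ξ) ∈ ω → (g, ξ') ∈ ω → ξ = ξ'}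

instance {Ξ : Type*} [TopologicalSpace Ξ] [MeasurableSpace G] [MeasurableSpace Ξ] :
    MeasurableSpace (MarkedConfig G Ξ) :=
  inferInstanceAs (MeasurableSpace {ω : Config (G × Ξ) // ∀ g ξ ξ', (g, ξ) ∈ ω → (g, ξ') ∈ ω → ξ = ξ'})

/-- The underlying set of points of a marked configuration. -/
def MarkedConfig.points {Ξ : Type*} [TopologicalSpace Ξ] (ω : MarkedConfig G Ξ) : Set G :=
  {g | ∃ ξ, (g, ξ) ∈ ω.1}

/-- `g • ω = {(g x, ξ) | (x, ξ) ∈ ω}`. -/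
instance {Ξ : Type*} [TopologicalSpace Ξ] : SMul G (MarkedConfig G Ξ) where
  smul g ω := ⟨ω.1.map ((Homeomorph.mulLeft g).prodCongr (Homeomorph.refl Ξ)), by
    rintro x ξ ξ' ⟨⟨a, b⟩, hp, h⟩ ⟨⟨a', b'⟩, hp', h'⟩
    obtain ⟨h1, h2⟩ := Prod.ext_iff.1 h
    obtain ⟨h1', h2'⟩ := Prod.ext_iff.1 h'
    simp only [Homeomorph.coe_prodCongr, Homeomorph.coe_mulLeft, Prod.map_apply,
      Homeomorph.refl_apply, id] at h1 h2 h1' h2'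
    have : a = a' := mul_left_cancel (h1.trans h1'.symm)
    subst this
    rw [← h2, ← h2']
    exact ω.2 a b b' hp hp'⟩

/-- The space of (directed) graphs in `G`: a vertex set `V ∈ 𝕄(G)` and an edge set
`E ∈ 𝕄(G × G)` with `E ⊆ V × V`. -/
def GraphSpace (G : Type*) [TopologicalSpace G] : Type _ :=
  {p : Config G × Config (G × G) // (p.2 : Set (G × G)) ⊆ (p.1 : Set G) ×ˢ (p.1 : Set G)}

instance [MeasurableSpace G] : MeasurableSpace (GraphSpace G) :=
  inferInstanceAs (MeasurableSpace
    {p : Config G × Config (G × G) // (p.2 : Set (G × G)) ⊆ (p.1 : Set G) ×ˢ (p.1 : Set G)})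

/-- The diagonal action of `G` on the space of graphs. -/
instance : SMul G (GraphSpace G) where
  smul g p := ⟨(g • p.1.1,
      p.1.2.map ((Homeomorph.mulLeft g).prodCongr (Homeomorph.mulLeft g))), by
    rintro _ ⟨⟨a, b⟩, hab, rfl⟩
    have := p.2 hab
    exact ⟨⟨a, this.1, rfl⟩, ⟨b, this.2, rfl⟩⟩⟩

/-! ### Factors of a point process -/

/-- `Φ` is a factor map of the point process `μ` with values in the `G`-space `X`, such that
`R ω (Φ ω)` holds. Such a map only needs to be defined, equivariant and subject to `R` on a
`G`-invariant Borel set `D` of full measure; off `D` its values are irrelevant. -/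
structure IsFactorMap {X : Type*} [MeasurableSpace G] [MeasurableSpace X] [SMul G X]
    (μ : Measure (Config G)) (R : Config G → X → Prop) (Φ : Config G → X) : Prop where
  measurable : Measurable Φ
  exists_domain : ∃ D : Set (Config G), MeasurableSet D ∧ μ Dᶜ = 0 ∧
    (∀ (g : G), ∀ ω ∈ D, g • ω ∈ D) ∧
    ∀ ω ∈ D, (∀ g : G, Φ (g • ω) = g • Φ ω) ∧ R ω (Φ ω)

/-- A factor thinning of `μ`: a factor map `θ : (𝕄, μ) → 𝕄` with `θ(ω) ⊆ ω`. -/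
def IsFactorThinning [MeasurableSpace G] (μ : Measure (Config G)) (θ : Config G → Config G) :
    Prop :=
  IsFactorMap μ (fun ω η : Config G => (η : Set G) ⊆ (ω : Set G)) θ

/-- A factor `Ξ`-marking of `μ`: a factor map `C : (𝕄, μ) → Ξ^𝕄` such that the underlying set of
`C(ω)` is `ω`. -/
def IsFactorMarking {Ξ : Type*} [TopologicalSpace Ξ] [MeasurableSpace G] [MeasurableSpace Ξ]
    (μ : Measure (Config G)) (C : Config G → MarkedConfig G Ξ) : Prop :=
  IsFactorMap μ (fun (ω : Config G) (η : MarkedConfig G Ξ) => η.points = (ω : Set G)) C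

/-- A factor graph of `μ`: a factor map from `(𝕄, μ)` to the space of graphs such that the vertex
set of the image of `ω` is `ω`. -/
def IsFactorGraph [MeasurableSpace G] (μ : Measure (Config G)) (Γ : Config G → GraphSpace G) :
    Prop :=
  IsFactorMap μ (fun (ω : Config G) (p : GraphSpace G) => p.1.1 = ω) Γ

/-! ### The rerooting groupoid -/

/-- The space `𝕄₀` of rooted configurations. -/
def Rooted (G : Type*) [Group G] [TopologicalSpace G] : Type _ := {ω : Config G // (1 : G) ∈ ω}

instance [MeasurableSpace G] : MeasurableSpace (Rooted G) :=
  inferInstanceAs (MeasurableSpace {ω : Config G // (1 : G) ∈ ω})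

/-- The space of birooted configurations `(ω, g)`, with `ω ∈ 𝕄₀` and `g ∈ ω`. -/
def Arrow (G : Type*) [Group G] [TopologicalSpace G] : Type _ :=
  {p : Rooted G × G // p.2 ∈ p.1.1}

instance [MeasurableSpace G] : MeasurableSpace (Arrow G) :=
  inferInstanceAs (MeasurableSpace {p : Rooted G × G // p.2 ∈ p.1.1})

/-- The rooted configuration `g⁻¹ω`, for a point `g` of `ω`. -/
def reroot (ω : Config G) (g : G) (h : g ∈ ω) : Rooted G :=
  ⟨g⁻¹ • ω, by rw [Config.mem_smul]; simpa using h⟩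

/-- A groupoid with set of units `X` and set of arrows `A`. The arrows `a`, `b` are composable, with
product `a · b`, if the target of `a` is the source of `b`. -/
structure UnitArrowGroupoid (X A : Type*) where
  source : A → X
  target : A → X
  unit : X → A
  inv : A → A
  mul : ∀ a b : A, target a = source b → A
  source_unit : ∀ x, source (unit x) = x
  target_unit : ∀ x, target (unit x) = x
  source_inv : ∀ a, source (inv a) = target a
  target_inv : ∀ a, target (inv a) = source a
  source_mul : ∀ a b h, source (mul a b h) = source a
  target_mul : ∀ a b h, target (mul a b h) = target b
  mul_assoc : ∀ a b c (hab : target a = source b) (hbc : target b = source c),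
    mul (mul a b hab) c ((target_mul a b hab).trans hbc) =
      mul a (mul b c hbc) (hab.trans (source_mul b c hbc).symm)
  unit_mul : ∀ a, mul (unit (source a)) a (target_unit _) = a
  mul_unit : ∀ a, mul a (unit (target a)) (source_unit _).symm = a
  mul_inv : ∀ a, mul a (inv a) (source_inv a).symm = unit (source a)
  inv_mul : ∀ a, mul (inv a) a (target_inv a) = unit (target a)

/-- A groupoid is Borel and `r`-discrete if its units and its arrows are standard Borel spaces, its
structure maps are Borel, and the fibres of the source and target maps are countable. -/
structure UnitArrowGroupoid.IsRDiscrete {X A : Type*} [MeasurableSpace X] [MeasurableSpace A]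
    (𝒢 : UnitArrowGroupoid X A) : Prop where
  standard_units : StandardBorelSpace X
  standard_arrows : StandardBorelSpace A
  measurable_source : Measurable 𝒢.source
  measurable_target : Measurable 𝒢.target
  measurable_unit : Measurable 𝒢.unit
  measurable_inv : Measurable 𝒢.inv
  measurable_mul : Measurable
    fun p : {p : A × A // 𝒢.target p.1 = 𝒢.source p.2} => 𝒢.mul p.1.1 p.1.2 p.2
  countable_source_fiber : ∀ x, (𝒢.source ⁻¹' {x}).Countable
  countable_target_fiber : ∀ x, (𝒢.target ⁻¹' {x}).Countable

theorem Rooted.ext' {ω η : Rooted G} (h : ω.1 = η.1) : ω = η := Subtype.ext h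

theorem Arrow.ext' {a b : Arrow G} (h : a.1.1 = b.1.1) (h' : a.1.2 = b.1.2) : a = b :=
  Subtype.ext (Prod.ext h h')

variable (G) in
/-- The rerooting groupoid on `𝕄₀`: the arrow `(ω, g)` goes from `ω` to `g⁻¹ω`, and
`(ω, g) · (g⁻¹ω, h) = (ω, gh)`. -/
def rerootingGroupoid : UnitArrowGroupoid (Rooted G) (Arrow G) where
  source a := a.1.1
  target a := reroot a.1.1.1 a.1.2 a.2
  unit ω := ⟨(ω, 1), ω.2⟩
  inv a := ⟨(reroot a.1.1.1 a.1.2 a.2, a.1.2⁻¹), by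
    change a.1.2⁻¹ ∈ (a.1.2⁻¹ • a.1.1.1 : Config G)
    rw [Config.mem_smul]; simpa using a.1.1.2⟩
  mul a b h := ⟨(a.1.1, a.1.2 * b.1.2), by
    have hb : b.1.2 ∈ b.1.1.1 := b.2
    rw [← h] at hb
    change b.1.2 ∈ (a.1.2⁻¹ • a.1.1.1 : Config G) at hb
    rw [Config.mem_smul, inv_inv] at hb
    exact hb⟩
  source_unit _ := rfl
  target_unit ω := Rooted.ext' (by simp [reroot])
  source_inv _ := rfl
  target_inv a := Rooted.ext' (by simp [reroot])
  source_mul _ _ _ := rfl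
  target_mul a b h := Rooted.ext' (by simp [reroot, ← h, mul_smul])
  mul_assoc a b c _ _ := Arrow.ext' rfl (mul_assoc _ _ _)
  unit_mul a := Arrow.ext' rfl (one_mul _)
  mul_unit a := Arrow.ext' rfl (mul_one _)
  mul_inv a := Arrow.ext' rfl (mul_inv_cancel _)
  inv_mul a := Arrow.ext' rfl (inv_mul_cancel _)

/-! ### Measurability of point counts

These facts make the measures below well defined. -/

section Measurability

theorem Config.measurable_count {Z : Type*} [TopologicalSpace Z] [MeasurableSpace Z] {U : Set Z}
    (hU : MeasurableSet U) : Measurable (Config.count U) := by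
  rw [measurable_iff_comap_le]
  exact le_iSup₂_of_le U hU le_rfl

theorem Config.measurable_of_count {Z α : Type*} [TopologicalSpace Z] [MeasurableSpace Z]
    [MeasurableSpace α] {f : α → Config Z}
    (h : ∀ U, MeasurableSet U → Measurable fun a => Config.count U (f a)) : Measurable f := by
  refine Measurable.of_comap_le ?_
  change MeasurableSpace.comap f (⨆ (U : Set Z) (_ : MeasurableSet U),
    MeasurableSpace.comap (Config.count U) ⊤) ≤ _
  rw [MeasurableSpace.comap_iSup]
  refine iSup_le fun U => ?_
  rw [MeasurableSpace.comap_iSup]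
  refine iSup_le fun hU => ?_
  rw [MeasurableSpace.comap_comp]
  exact (h U hU).comap_le

theorem encard_iUnion_eq_tsum {Z : Type*} {f : ℕ → Set Z} (hd : Pairwise (Disjoint on f)) :
    (((⋃ i, f i).encard : ℕ∞) : ℝ≥0∞) = ∑' i, ((f i).encard : ℝ≥0∞) := by
  let _ : MeasurableSpace Z := ⊤
  have h := measure_iUnion (μ := Measure.count) hd (fun _ => MeasurableSpace.measurableSet_top)
  simpa only [Measure.count_apply MeasurableSpace.measurableSet_top] using h

theorem Config.countable {Z : Type*} [TopologicalSpace Z] [SecondCountableTopology Z]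
    (ω : Config Z) : (ω : Set Z).Countable := by
  have := ω.isDiscrete.to_subtype
  have h : Countable (ω.carrier) := TopologicalSpace.separableSpace_iff_countable.1 inferInstance
  exact h

variable {Z : Type*} [TopologicalSpace Z] [LocallyCompactSpace Z] [SecondCountableTopology Z]
  [T2Space Z] [MeasurableSpace Z] [BorelSpace Z]

theorem Config.finite_inter (ω : Config Z) {K : Set Z} (hK : IsCompact K) :
    ((ω : Set Z) ∩ K).Finite :=
  (hK.inter_left ω.isClosed).finite (ω.isDiscrete.mono inter_subset_left)

variable (Z) in
/-- The counting measure on the points of a configuration, as a measurable function of the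
configuration. -/
def pointKernel : Kernel (Config Z) Z where
  toFun ω := Measure.count.restrict (ω : Set Z)
  measurable' := by
    refine Measure.measurable_of_measurable_coe _ fun U hU => ?_
    have : (fun ω : Config Z => (Measure.count.restrict (ω : Set Z)) U) =
        fun ω => ((Config.count U ω : ℕ∞) : ℝ≥0∞) := by
      ext ω
      rw [Measure.restrict_apply hU, Measure.count_apply (hU.inter ω.countable.measurableSet),
        inter_comm]
      rfl
    rw [this]
    exact (measurable_from_top (f := fun n : ℕ∞ => (n : ℝ≥0∞))).comp (Config.measurable_count hU)

theorem pointKernel_apply (ω : Config Z) (U : Set Z) :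
    pointKernel Z ω U = (((ω : Set Z) ∩ U).encard : ℝ≥0∞) := by
  change Measure.count.restrict (ω : Set Z) U = _
  rw [Measure.restrict_apply' ω.countable.measurableSet, inter_comm, Measure.count_apply]
  exact (ω.countable.mono inter_subset_left).measurableSet

instance : IsSFiniteKernel (pointKernel Z) := by
  classical
  let C : ℕ → Set Z := disjointed (compactCovering Z)
  have hC : ∀ n, MeasurableSet (C n) :=
    MeasurableSet.disjointed fun n => (isCompact_compactCovering Z n).measurableSet
  have hlev : ∀ k n : ℕ, MeasurableSet {ω : Config Z | Config.count (C k) ω = n} := fun k n =>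
    Config.measurable_count (hC k) (measurableSet_singleton (n : ℕ∞))
  let κ : ℕ × ℕ → Kernel (Config Z) Z := fun p =>
    Kernel.piecewise (hlev p.1 p.2) ((pointKernel Z).restrict (hC p.1)) 0
  have hκ : ∀ p, IsSFiniteKernel (κ p) := by
    intro p
    have : IsFiniteKernel (κ p) := by
      refine ⟨⟨(p.2 : ℝ≥0∞), ENNReal.natCast_lt_top _, fun ω => ?_⟩⟩
      rw [Kernel.piecewise_apply']
      split_ifs with h
      · rw [Kernel.restrict_apply' _ _ _ MeasurableSet.univ, univ_inter, pointKernel_apply]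
        change ((Config.count (C p.1) ω : ℕ∞) : ℝ≥0∞) ≤ _
        rw [show Config.count (C p.1) ω = (p.2 : ℕ∞) from h]
        simp
      · simp
    infer_instance
  have : pointKernel Z = Kernel.sum κ := by
    ext ω U hU
    rw [Kernel.sum_apply' _ _ hU, ENNReal.tsum_prod (f := fun k n => κ (k, n) ω U)]
    have hk : ∀ k, ∑' n, κ (k, n) ω U = pointKernel Z ω (U ∩ C k) := by
      intro k
      have hfin : ((ω : Set Z) ∩ C k).Finite :=
        (ω.finite_inter (isCompact_compactCovering Z k)).subset
          (inter_subset_inter_right _ (disjointed_subset _ _))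
      obtain ⟨m, hm⟩ : ∃ m : ℕ, Config.count (C k) ω = m :=
        ⟨_, hfin.cast_ncard_eq.symm⟩
      rw [tsum_eq_single m]
      · rw [Kernel.piecewise_apply']
        exact (if_pos hm).trans (Kernel.restrict_apply' _ _ _ hU)
      · intro n hn
        rw [Kernel.piecewise_apply']
        refine (if_neg fun h => hn ?_).trans (by simp)
        have h' : Config.count (C k) ω = (n : ℕ∞) := h
        exact_mod_cast h'.symm.trans hm
    simp_rw [hk]
    rw [← measure_iUnion, ← inter_iUnion, iUnion_disjointed, iUnion_compactCovering, inter_univ]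
    · exact fun i j hij => ((disjoint_disjointed _ hij).mono inter_subset_right inter_subset_right)
    · exact fun k => hU.inter (hC k)
  rw [this]
  infer_instance

theorem measurable_toENNReal : Measurable fun n : ℕ∞ => (n : ℝ≥0∞) := measurable_from_top

theorem measurable_of_toENNReal {α : Type*} [MeasurableSpace α] {f : α → ℕ∞}
    (h : Measurable fun a => (f a : ℝ≥0∞)) : Measurable f := by
  refine measurable_to_countable' fun n => ?_
  convert h (measurableSet_singleton (n : ℝ≥0∞)) using 1
  ext a
  simp

/-- Counting those points of a measurably varying configuration that satisfy a measurable
condition is measurable. -/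
theorem measurable_encard_points {α : Type*} [MeasurableSpace α] {f : α → Config Z}
    (hf : Measurable f) {S : Set (α × Z)} (hS : MeasurableSet S) :
    Measurable fun a => {z | z ∈ f a ∧ (a, z) ∈ S}.encard := by
  refine measurable_of_toENNReal ?_
  have h := Kernel.measurable_kernel_prodMk_left (κ := (pointKernel Z).comap f hf) hS
  convert h using 2 with a
  rw [Kernel.comap_apply, pointKernel_apply]
  rfl

variable [LocallyCompactSpace G] [SecondCountableTopology G] [T2Space G] [MeasurableSpace G]
  [BorelSpace G]

theorem measurable_inv_smul : Measurable fun p : Config G × G => p.2⁻¹ • p.1 := by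
  refine Config.measurable_of_count fun U hU => ?_
  have hS : MeasurableSet {q : (Config G × G) × G | q.1.2⁻¹ * q.2 ∈ U} :=
    ((measurable_fst.snd.inv).mul measurable_snd) hU
  have h := measurable_encard_points (f := fun p : Config G × G => p.1) measurable_fst hS
  convert h using 2 with p
  have he : ((p.2⁻¹ • p.1 : Config G) : Set G) ∩ U =
      (fun x => p.2⁻¹ * x) '' {z | z ∈ p.1 ∧ (p, z) ∈ {q : (Config G × G) × G | q.1.2⁻¹ * q.2 ∈ U}} := by
    ext x
    constructor
    · rintro ⟨⟨y, hy, rfl⟩, hx⟩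
      exact ⟨y, ⟨hy, hx⟩, rfl⟩
    · rintro ⟨y, ⟨hy, hx⟩, rfl⟩
      exact ⟨⟨y, hy, rfl⟩, hx⟩
  rw [Config.count, he, (mul_right_injective _).encard_image]

theorem measurable_rerooting_target : Measurable (rerootingGroupoid G).target := by
  refine Measurable.subtype_mk ?_
  exact measurable_inv_smul.comp
    ((measurable_subtype_coe.comp (measurable_fst.comp measurable_subtype_coe)).prodMk
      (measurable_snd.comp measurable_subtype_coe))

theorem measurable_rerooting_inv : Measurable (rerootingGroupoid G).inv :=
  Measurable.subtype_mk (measurable_rerooting_target.prodMk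
    (measurable_snd.comp measurable_subtype_coe).inv)

theorem measurable_source_fiber {S : Set (Arrow G)} (hS : MeasurableSet S) :
    Measurable fun ω => ((rerootingGroupoid G).source ⁻¹' {ω} ∩ S).encard := by
  obtain ⟨S', hS', rfl⟩ := hS
  have h := measurable_encard_points (f := fun ω : Rooted G => ω.1) measurable_subtype_coe hS'
  refine (congrArg Measurable (funext fun ω => ?_)).mp h
  have he : {z | z ∈ ω.1 ∧ (ω, z) ∈ S'} = (fun a : Arrow G => a.1.2) ''
      ((rerootingGroupoid G).source ⁻¹' {ω} ∩ Subtype.val ⁻¹' S') := by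
    ext z
    constructor
    · rintro ⟨hz, hzS⟩
      exact ⟨⟨(ω, z), hz⟩, ⟨rfl, hzS⟩, rfl⟩
    · rintro ⟨⟨⟨η, g⟩, hg⟩, ⟨rfl, hzS⟩, rfl⟩
      exact ⟨hg, hzS⟩
  rw [he]
  refine InjOn.encard_image ?_
  rintro a ⟨ha, _⟩ b ⟨hb, _⟩ hab
  exact Arrow.ext' (ha.trans hb.symm) hab

theorem measurable_target_fiber {S : Set (Arrow G)} (hS : MeasurableSet S) :
    Measurable fun ω => ((rerootingGroupoid G).target ⁻¹' {ω} ∩ S).encard := by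
  have hinv : Involutive (rerootingGroupoid G).inv := fun a =>
    by
    refine Arrow.ext' ?_ (inv_inv _)
    exact (rerootingGroupoid G).target_inv a
  refine (congrArg Measurable (funext fun ω => ?_)).mp
    (measurable_source_fiber (measurable_rerooting_inv hS))
  rw [← hinv.injective.encard_image]
  congr 1
  ext a
  constructor
  · rintro ⟨b, ⟨hb, hbS⟩, rfl⟩
    exact ⟨((rerootingGroupoid G).target_inv b).trans hb, hbS⟩
  · rintro ⟨ha, haS⟩
    exact ⟨_, ⟨ha, by rwa [mem_preimage, hinv]⟩, hinv a⟩

end Measurability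

/-! ### The Palm measure and the measures on the arrow space -/

section Measures

variable [LocallyCompactSpace G] [SecondCountableTopology G] [T2Space G] [MeasurableSpace G]
  [BorelSpace G]

/-- The number of points `g ∈ U` of `ω` with `g⁻¹ω ∈ A`. -/
def rerootCount (U : Set G) (A : Set (Rooted G)) (ω : Config G) : ℕ∞ :=
  {g | g ∈ U ∧ ∃ h : g ∈ ω, reroot ω g h ∈ A}.encard

theorem measurable_rerootCount {U : Set G} (hU : MeasurableSet U) {A : Set (Rooted G)}
    (hA : MeasurableSet A) : Measurable (rerootCount U A) := by
  obtain ⟨A', hA', rfl⟩ := hA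
  have hS : MeasurableSet {p : Config G × G | p.2 ∈ U ∧ p.2⁻¹ • p.1 ∈ A'} :=
    (measurable_snd hU).inter (measurable_inv_smul hA')
  refine (congrArg Measurable (funext fun ω => ?_)).mp (measurable_encard_points measurable_id hS)
  refine congrArg Set.encard (Set.ext fun g => Iff.symm ?_)
  exact ⟨fun ⟨hg, h, hA⟩ => ⟨h, hg, hA⟩, fun ⟨h, hg, hA⟩ => ⟨hg, h, hA⟩⟩

/-- The intensity `E_μ[#(ω ∩ U)] / λ(U)` of a point process `μ`. For an invariant `μ` it does not
depend on the Borel set `U` of positive and finite measure. -/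
def intensity (haar : Measure G) (μ : Measure (Config G)) (U : Set G) : ℝ≥0∞ :=
  (∫⁻ ω, (Config.count U ω : ℝ≥0∞) ∂μ) / haar U

/-- The (normalised) Palm measure `μ₀` of `μ`, the measure on `𝕄₀` given by
`μ₀(A) = int(μ)⁻¹ E_μ[#{g ∈ U ∩ ω | g⁻¹ω ∈ A}] / λ(U)`. -/
def palmMeasure (haar : Measure G) (μ : Measure (Config G)) (U : Set G) (hU : MeasurableSet U) :
    Measure (Rooted G) :=
  Measure.ofMeasurable
    (fun A _ => (intensity haar μ U)⁻¹ *
      ((∫⁻ ω, (rerootCount U A ω : ℝ≥0∞) ∂μ) / haar U))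
    (by simp [rerootCount])
    (by
      intro f hf hd
      have h1 : ∀ ω, (rerootCount U (⋃ i, f i) ω : ℝ≥0∞) =
          ∑' i, (rerootCount U (f i) ω : ℝ≥0∞) := by
        intro ω
        unfold rerootCount
        rw [← encard_iUnion_eq_tsum]
        · congr 2
          ext g
          simp only [mem_ofPred_eq, mem_iUnion]
          tauto
        · intro i j hij
          rw [Function.onFun, Set.disjoint_left]
          rintro g ⟨_, _, hi⟩ ⟨_, _, hj⟩
          exact Set.disjoint_left.1 (hd hij) hi hj
      have h2 : ∀ i, AEMeasurable (fun ω => (rerootCount U (f i) ω : ℝ≥0∞)) μ := fun i =>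
        (measurable_toENNReal.comp (measurable_rerootCount hU (hf i))).aemeasurable
      simp_rw [h1]
      rw [lintegral_tsum h2]
      simp only [div_eq_mul_inv, ENNReal.tsum_mul_left, ENNReal.tsum_mul_right])

/-- The measure `S ↦ ∫ #(p⁻¹(x) ∩ S) dm(x)` on `A` induced by a measure `m` on `X` and a map
`p : A → X`. -/
def fiberMeasure {X A : Type*} [MeasurableSpace X] [MeasurableSpace A] (p : A → X)
    (hp : ∀ S, MeasurableSet S → Measurable fun x => (p ⁻¹' {x} ∩ S).encard) (m : Measure X) :
    Measure A :=
  Measure.ofMeasurable (fun S _ => ∫⁻ x, ((p ⁻¹' {x} ∩ S).encard : ℝ≥0∞) ∂m)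
    (by simp)
    (by
      intro f hf hd
      have h1 : ∀ x, ((p ⁻¹' {x} ∩ ⋃ i, f i).encard : ℝ≥0∞) =
          ∑' i, ((p ⁻¹' {x} ∩ f i).encard : ℝ≥0∞) := by
        intro x
        rw [inter_iUnion, encard_iUnion_eq_tsum]
        exact fun i j hij => (hd hij).mono inter_subset_right inter_subset_right
      simp_rw [h1]
      exact lintegral_tsum fun i => (measurable_toENNReal.comp (hp _ (hf i))).aemeasurable)

/-- The measure on the arrow space induced by `μ₀` and the source map. -/
def sourceMeasure (μ₀ : Measure (Rooted G)) : Measure (Arrow G) :=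
  fiberMeasure (rerootingGroupoid G).source (fun _ hS => measurable_source_fiber hS) μ₀

/-- The measure on the arrow space induced by `μ₀` and the target map. -/
def targetMeasure (μ₀ : Measure (Rooted G)) : Measure (Arrow G) :=
  fiberMeasure (rerootingGroupoid G).target (fun _ hS => measurable_target_fiber hS) μ₀

end Measures

/-! ### Factors and subsets of the groupoid -/

/-- `A_θ = {ω ∈ 𝕄₀ | 1 ∈ θ(ω)}`. -/
def unitSet (θ : Config G → Config G) : Set (Rooted G) := {ω | (1 : G) ∈ θ ω.1}

/-- `θ^A(ω) = {g ∈ ω | g⁻¹ω ∈ A}`. -/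
def thinning (A : Set (Rooted G)) (ω : Config G) : Config G :=
  ω.sub {g | ∃ h : g ∈ ω, reroot ω g h ∈ A} fun _ hg => hg.1

open Classical in
/-- `P_C(ω)` is the mark of the root in `C(ω)`, for `ω ∈ 𝕄₀` (an arbitrary constant for those `ω`
for which the root is not a point of `C(ω)`). -/
def rootMark {Ξ : Type*} [TopologicalSpace Ξ] [Nonempty Ξ] (C : Config G → MarkedConfig G Ξ)
    (ω : Rooted G) : Ξ :=
  if h : ∃ ξ, ((1 : G), ξ) ∈ (C ω.1).1 then h.choose else Classical.arbitrary Ξ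

/-- `C^P(ω) = {(g, P(g⁻¹ω)) | g ∈ ω}`. -/
def marking {Ξ : Type*} [TopologicalSpace Ξ] [T1Space Ξ] (P : Rooted G → Ξ) (ω : Config G) :
    MarkedConfig G Ξ :=
  ⟨{ carrier := {p | ∃ h : p.1 ∈ ω, P (reroot ω p.1 h) = p.2}
     isClosed := by
       have h : {p : G × Ξ | ∃ h : p.1 ∈ ω, P (reroot ω p.1 h) = p.2}ᶜ =
           {p : G × Ξ | p.1 ∈ (ω : Set G)ᶜ} ∪
             ⋃ g : ω, ((ω : Set G) \ {g.1})ᶜ ×ˢ ({P (reroot ω g.1 g.2)} : Set Ξ)ᶜ := by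
         ext ⟨g, ξ⟩
         constructor
         · intro h
           by_cases hg : g ∈ ω
           · refine Or.inr (mem_iUnion.2 ⟨⟨g, hg⟩, fun h' => h'.2 rfl, fun e => h ⟨hg, ?_⟩⟩)
             exact e.symm
           · exact Or.inl hg
         · rintro (h | h) ⟨hg, e⟩
           · exact h hg
           · obtain ⟨⟨g', hg'⟩, h1, h2⟩ := mem_iUnion.1 h
             have hgg : g = g' := by_contra fun hne => h1 ⟨hg, hne⟩
             subst hgg
             exact h2 e.symm
       rw [← isOpen_compl_iff, h]
       refine (ω.isClosed.isOpen_compl.preimage continuous_fst).union (isOpen_iUnion fun g => ?_)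
       refine IsOpen.prod ?_ isOpen_compl_singleton
       exact (isClosed_of_subset_discrete_closed sdiff_subset ω.isDiscrete ω.isClosed).isOpen_compl
     isDiscrete := by
       rw [isDiscrete_iff_forall_mem_exists_isOpen]
       rintro ⟨g, ξ⟩ ⟨hg, e₀⟩
       replace e₀ : P (reroot ω g hg) = ξ := e₀
       obtain ⟨u, hu, hug⟩ := isDiscrete_iff_forall_mem_exists_isOpen.1 ω.isDiscrete g hg
       refine ⟨_, hu.preimage (continuous_fst (Y := Ξ)), ?_⟩
       ext ⟨g', ξ'⟩
       constructor
       · rintro ⟨hgu, hg', e⟩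
         have : g' ∈ ({g} : Set G) := hug ▸ ⟨hgu, hg'⟩
         obtain rfl : g' = g := this
         exact Prod.ext rfl (e.symm.trans e₀)
       · rintro h
         obtain ⟨rfl, rfl⟩ := Prod.ext_iff.1 h
         have : g' ∈ u ∩ ω.carrier := hug ▸ rfl
         exact ⟨this.1, hg, e₀⟩ }, by
    rintro g ξ ξ' ⟨h, e⟩ ⟨h', e'⟩
    exact e.symm.trans e'⟩

/-- `𝒜_Γ = {(ω, g) | (1, g) is an edge of Γ(ω)}`. -/
def arrowSet (Γ : Config G → GraphSpace G) : Set (Arrow G) :=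
  {a | ((1 : G), a.1.2) ∈ (Γ a.1.1.1).1.2}

/-- The arrow `(g⁻¹ω, g⁻¹h)`, for points `g` and `h` of `ω`. -/
def rerootArrow (ω : Config G) (g h : G) (hg : g ∈ ω) (hh : h ∈ ω) : Arrow G :=
  ⟨(reroot ω g hg, g⁻¹ * h), by
    change g⁻¹ * h ∈ (g⁻¹ • ω : Config G)
    rw [Config.mem_smul]; simpa using hh⟩

/-- The complete graph (with loops) on the points of `ω`. -/
def completeEdges (ω : Config G) : Config (G × G) where
  carrier := (ω : Set G) ×ˢ (ω : Set G)
  isClosed := ω.isClosed.prod ω.isClosed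
  isDiscrete := by
    rw [isDiscrete_iff_forall_mem_exists_isOpen]
    rintro ⟨g, h⟩ ⟨hg, hh⟩
    obtain ⟨u, hu, hug⟩ := isDiscrete_iff_forall_mem_exists_isOpen.1 ω.isDiscrete g hg
    obtain ⟨v, hv, hvh⟩ := isDiscrete_iff_forall_mem_exists_isOpen.1 ω.isDiscrete h hh
    refine ⟨u ×ˢ v, hu.prod hv, ?_⟩
    rw [Set.prod_inter_prod]
    exact (congrArg₂ _ hug hvh).trans Set.singleton_prod_singleton

/-- `Γ^𝒜(ω)` is the graph with vertex set `ω` and edge set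
`{(g, h) ∈ ω × ω | (g⁻¹ω, g⁻¹h) ∈ 𝒜}`. -/
def factorGraph (𝒜 : Set (Arrow G)) (ω : Config G) : GraphSpace G :=
  ⟨(ω, (completeEdges ω).sub
      {p | ∃ (hg : p.1 ∈ ω) (hh : p.2 ∈ ω), rerootArrow ω p.1 p.2 hg hh ∈ 𝒜}
      fun _ hp => ⟨hp.1, hp.2.1⟩),
    fun _ hp => ⟨hp.1, hp.2.1⟩⟩

/-- The maps `F` and `H` induce mutually inverse bijections between the objects satisfying `P`,
taken up to the equivalence `r`, and the objects satisfying `Q`, taken up to the equivalence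
`s`. -/
structure IsCorrespondence {α β : Type*} (P : α → Prop) (r : α → α → Prop) (Q : β → Prop)
    (s : β → β → Prop) (F : α → β) (H : β → α) : Prop where
  mapsTo : ∀ a, P a → Q (F a)
  mapsTo' : ∀ b, Q b → P (H b)
  congr : ∀ a a', P a → P a' → (r a a' ↔ s (F a) (F a'))
  congr' : ∀ b b', Q b → Q b' → (s b b' ↔ r (H b) (H b'))
  left_inv : ∀ a, P a → r (H (F a)) a
  right_inv : ∀ b, Q b → s (F (H b)) b

end Group

end

end PointProcess

open PointProcess

/-! Everything about the Palm measure is read off the Campbell measure `campbell μ` on `G × Config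
G`, whose value on `V ×ˢ A` is the expected number of points `g ∈ ω ∩ V` with `g⁻¹ω ∈ A`. For fixed
`A`, invariance of `μ` makes this a left invariant measure in `V`, so by uniqueness of Haar measure
it is a multiple of `haar` (`campbell_prod_eq`). Hence the Campbell measure is the intensity times
the product of `haar` and the Palm measure (`campbell_eq_smul_prod`), and neither factor depends on
the window `U`.

Two consequences carry the rest. First, a Borel property holds Palm-almost everywhere if and only
if, for `μ`-almost every `ω`, it holds for the rerooting of `ω` at every one of its points
(`ae_palmMeasure_iff`). Second, if `haar` is also right invariant, evaluating a double sum over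
pairs of points of `ω` in two ways gives the mass transport principle (`lintegral_palmMeasure_inv`),
that is, invariance of the arrow measure under inversion.

For the correspondences, passing from a root object to a factor and back is the identity. In the
other direction, equivariance shows that a factor at `g` is determined by its value at the root of
`g⁻¹ω`, which recovers it almost surely. The two notions of almost everywhere equality match by the
transfer of null sets above.

The remaining point is that `Config Z` is standard Borel. Cut `Z` into countably many relatively
compact Borel shells and list the finitely many points in each shell in increasing order of a Borel
injection into `ℝ`. The lists form a Borel set in a standard Borel space and map bijectively and
measurably onto `Config Z`; Lusin–Souslin makes this a Borel isomorphism. -/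

namespace PointProcess

/-! ### Configuration spaces are standard Borel -/

section StandardBorel

variable {Z : Type*} [TopologicalSpace Z] [MeasurableSpace Z]

omit [MeasurableSpace Z] in
theorem Config.one_le_count_iff {U : Set Z} {ω : Config Z} :
    1 ≤ Config.count U ω ↔ ∃ z ∈ ω, z ∈ U := by
  rw [Config.count, Set.one_le_encard_iff_nonempty]
  rfl

theorem Config.measurableSet_exists_mem {U : Set Z} (hU : MeasurableSet U) :
    MeasurableSet {ω : Config Z | ∃ z ∈ ω, z ∈ U} := by
  simp_rw [← Config.one_le_count_iff]
  exact Config.measurable_count hU (MeasurableSet.of_discrete (s := Ici (1 : ℕ∞)))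

/-- A closed set is determined by the basic open sets that it meets: a point outside it has a basic
neighbourhood missing it. Countable separation is what Lusin–Souslin needs of the target. -/
instance [SecondCountableTopology Z] [BorelSpace Z] :
    MeasurableSpace.CountablySeparated (Config Z) := by
  refine ⟨⟨⟨(fun U : Set Z => {ω : Config Z | ∃ z ∈ ω, z ∈ U}) ''
    TopologicalSpace.countableBasis Z, (TopologicalSpace.countable_countableBasis Z).image _,
    ?_, ?_⟩⟩⟩
  · rintro _ ⟨U, hU, rfl⟩
    exact Config.measurableSet_exists_mem
      (TopologicalSpace.isOpen_of_mem_countableBasis hU).measurableSet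
  · have key : ∀ ω η : Config Z, (∀ U ∈ TopologicalSpace.countableBasis Z,
        (∃ z ∈ ω, z ∈ U) → ∃ z ∈ η, z ∈ U) → (ω : Set Z) ⊆ η := by
      intro ω η h z hz
      by_contra hη
      obtain ⟨U, hU, hzU, hUη⟩ := (TopologicalSpace.isBasis_countableBasis Z).exists_subset_of_mem_open
        (show z ∈ (η : Set Z)ᶜ from hη) η.isClosed.isOpen_compl
      obtain ⟨y, hy, hyU⟩ := h U hU ⟨z, hz, hzU⟩
      exact hUη hyU hy
    intro ω _ η _ h
    refine SetLike.coe_injective (Subset.antisymm (key ω η fun U hU => ?_) (key η ω fun U hU => ?_))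
    · exact (h _ (mem_image_of_mem _ hU)).1
    · exact (h _ (mem_image_of_mem _ hU)).2

theorem StandardBorelSpace.of_measurableEquiv {α β : Type*} [MeasurableSpace α] [MeasurableSpace β]
    [StandardBorelSpace β] (e : α ≃ᵐ β) : StandardBorelSpace α := by
  let := upgradeStandardBorel β
  let : TopologicalSpace α := TopologicalSpace.induced e inferInstance
  have : PolishSpace α := e.toEquiv.polishSpace_induced
  have : BorelSpace α := e.measurableEmbedding.borelSpace ⟨rfl⟩
  infer_instance

/-- A locally compact second countable Hausdorff space is standard Borel. -/
theorem standardBorelSpace_of_locallyCompact [LocallyCompactSpace Z] [SecondCountableTopology Z]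
    [T2Space Z] [BorelSpace Z] : StandardBorelSpace Z := by
  let := TopologicalSpace.metrizableSpaceMetric Z
  let : MeasurableSpace (UniformSpace.Completion Z) := borel _
  have : BorelSpace (UniformSpace.Completion Z) := ⟨rfl⟩
  -- The metric on `Z` need not be complete, but `Z` is `σ`-compact, so its image in the Polish
  -- completion is a countable union of compact sets and hence Borel.
  have hr : MeasurableSet (range ((↑) : Z → UniformSpace.Completion Z)) := by
    rw [← image_univ, ← iUnion_compactCovering, image_iUnion]
    exact MeasurableSet.iUnion fun n => ((isCompact_compactCovering Z n).image
      (UniformSpace.Completion.continuous_coe Z)).measurableSet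
  have hemb := (UniformSpace.Completion.isUniformEmbedding_coe Z).isEmbedding.measurableEmbedding hr
  have := hr.standardBorel
  exact StandardBorelSpace.of_measurableEquiv hemb.equivRange

variable [LocallyCompactSpace Z] [SecondCountableTopology Z] [T2Space Z] [BorelSpace Z]

/-- The `n`-th shell of a compact exhaustion. -/
def shell (Z : Type*) [TopologicalSpace Z] [LocallyCompactSpace Z] [SecondCountableTopology Z]
    [T2Space Z] : ℕ → Set Z :=
  disjointed (CompactExhaustion.choice Z)

theorem measurableSet_shell (n : ℕ) : MeasurableSet (shell Z n) :=
  MeasurableSet.disjointed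
    (fun n => ((CompactExhaustion.choice Z).isCompact n).measurableSet) n

omit [MeasurableSpace Z] [BorelSpace Z] in
theorem exists_mem_shell (z : Z) : ∃ n, z ∈ shell Z n := by
  rw [← mem_iUnion, shell, iUnion_disjointed, CompactExhaustion.iUnion_eq]
  trivial

omit [MeasurableSpace Z] [BorelSpace Z] in
theorem eq_of_mem_shell {m n : ℕ} {z : Z} (hm : z ∈ shell Z m) (hn : z ∈ shell Z n) : m = n := by
  by_contra h
  exact disjoint_left.1 (disjoint_disjointed (CompactExhaustion.choice Z) h) hm hn

omit [MeasurableSpace Z] [BorelSpace Z] in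
/-- A set with finitely many points in each shell is locally finite. -/
theorem finite_inter_nhds_of_finite_inter_shell {s : Set Z} (h : ∀ n, (s ∩ shell Z n).Finite)
    (z : Z) : ∃ V, IsOpen V ∧ z ∈ V ∧ (s ∩ V).Finite := by
  let K := CompactExhaustion.choice Z
  obtain ⟨n, hn⟩ := K.exists_mem_nhds z
  refine ⟨interior (K n), isOpen_interior, mem_interior_iff_mem_nhds.2 hn, ?_⟩
  refine ((finite_Iic n).biUnion fun m _ => h m).subset ?_
  rintro y ⟨hys, hy⟩
  -- The sets of an exhaustion increase, so the `n`-th one is covered by the shells of index at most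
  -- `n`.
  have : y ∈ ⋃ i ≤ n, shell Z i := by
    have h1 : y ∈ partialSups K n := by
      rw [partialSups_eq_accumulate]
      exact mem_iUnion₂.2 ⟨n, le_rfl, interior_subset hy⟩
    rw [← partialSups_disjointed, partialSups_eq_accumulate] at h1
    exact h1
  obtain ⟨i, hi, hyi⟩ := mem_iUnion₂.1 this
  exact mem_iUnion₂.2 ⟨i, hi, hys, hyi⟩

/-- The configuration of the points of a set that has finitely many points in each shell. -/
def Config.ofFiniteInterShell (s : Set Z) (h : ∀ n, (s ∩ shell Z n).Finite) : Config Z where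
  carrier := s
  isClosed := by
    rw [← isOpen_compl_iff, isOpen_iff_mem_nhds]
    intro z hz
    obtain ⟨V, hV, hzV, hfin⟩ := finite_inter_nhds_of_finite_inter_shell h z
    filter_upwards [hV.mem_nhds hzV, hfin.isClosed.isOpen_compl.mem_nhds (fun h => hz h.1)]
      with y hy hy' hys
    exact hy' ⟨hys, hy⟩
  isDiscrete := by
    rw [isDiscrete_iff_forall_mem_exists_isOpen]
    intro z hz
    obtain ⟨V, hV, hzV, hfin⟩ := finite_inter_nhds_of_finite_inter_shell h z
    refine ⟨V \ ((s ∩ V) \ {z}), hV.sdiff (hfin.subset sdiff_subset).isClosed, ?_⟩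
    ext y
    constructor
    · rintro ⟨⟨hyV, hy⟩, hys⟩
      by_contra hne
      exact hy ⟨⟨hys, hyV⟩, hne⟩
    · rintro rfl
      exact ⟨⟨hzV, fun h => h.2 rfl⟩, hz⟩

theorem Config.finite_inter_shell (ω : Config Z) (n : ℕ) : ((ω : Set Z) ∩ shell Z n).Finite :=
  (ω.finite_inter ((CompactExhaustion.choice Z).isCompact n)).subset
    (inter_subset_inter_right _ (disjointed_subset _ _))

/-- Codes of configurations: a code consists of the number `k n` of points in the `n`-th shell and
of an enumeration `x n` of these points that is increasing with respect to `e`, continued by the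
constant `z₀`. -/
def Code (e : Z → ℝ) (z₀ : Z) : Set ((ℕ → ℕ) × (ℕ → ℕ → Z)) :=
  {p | ∀ n i, (i < p.1 n → p.2 n i ∈ shell Z n ∧ ∀ j < i, e (p.2 n j) < e (p.2 n i)) ∧
    (p.1 n ≤ i → p.2 n i = z₀)}

theorem measurableSet_code {e : Z → ℝ} (he : Measurable e) (z₀ : Z) :
    MeasurableSet (Code e z₀) := by
  have hx : ∀ n i, Measurable fun p : (ℕ → ℕ) × (ℕ → ℕ → Z) => p.2 n i := fun n i => by fun_prop
  have hk : ∀ n, Measurable fun p : (ℕ → ℕ) × (ℕ → ℕ → Z) => p.1 n := fun n => by fun_prop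
  simp only [Code, ofPred_forall]
  refine MeasurableSet.iInter fun n => MeasurableSet.iInter fun i => MeasurableSet.inter ?_ ?_
  · refine MeasurableSet.imp (measurableSet_lt measurable_const (hk n)) (MeasurableSet.inter
      (hx n i (measurableSet_shell n)) ?_)
    change MeasurableSet {p : (ℕ → ℕ) × (ℕ → ℕ → Z) | ∀ j < i, e (p.2 n j) < e (p.2 n i)}
    simp only [ofPred_forall]
    exact MeasurableSet.iInter fun j => MeasurableSet.iInter fun _ =>
      measurableSet_lt (he.comp (hx n j)) (he.comp (hx n i))
  · exact MeasurableSet.imp (measurableSet_le (hk n) measurable_const)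
      (hx n i (measurableSet_singleton z₀))

/-- The points listed by a code. -/
def Code.points (p : (ℕ → ℕ) × (ℕ → ℕ → Z)) : Set Z := {z | ∃ n, ∃ i < p.1 n, p.2 n i = z}

omit [MeasurableSpace Z] [BorelSpace Z] in
theorem Code.points_inter_shell {e : Z → ℝ} {z₀ : Z} {p : (ℕ → ℕ) × (ℕ → ℕ → Z)}
    (hp : p ∈ Code e z₀) (n : ℕ) : Code.points p ∩ shell Z n = range fun i : Fin (p.1 n) => p.2 n i := by
  ext z
  constructor
  · rintro ⟨⟨m, i, hi, rfl⟩, hz⟩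
    obtain rfl := eq_of_mem_shell ((hp m i).1 hi).1 hz
    exact ⟨⟨i, hi⟩, rfl⟩
  · rintro ⟨i, rfl⟩
    exact ⟨⟨n, i, i.2, rfl⟩, ((hp n i).1 i.2).1⟩

omit [MeasurableSpace Z] [BorelSpace Z] in
theorem Code.strictMono {e : Z → ℝ} {z₀ : Z} {p : (ℕ → ℕ) × (ℕ → ℕ → Z)}
    (hp : p ∈ Code e z₀) (n : ℕ) : StrictMono fun i : Fin (p.1 n) => e (p.2 n i) :=
  fun i j hij => ((hp n j).1 j.2).2 i hij

/-- The configuration listed by a code. -/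
def Code.config {e : Z → ℝ} {z₀ : Z} (p : Code e z₀) : Config Z :=
  Config.ofFiniteInterShell (Code.points p.1) fun n => by
    rw [Code.points_inter_shell p.2]; exact finite_range _

omit [MeasurableSpace Z] [BorelSpace Z] in
-- The configuration determines the set of listed points in each shell, hence their number and their
-- increasing enumeration. Beyond that number the entries are the constant `z₀`.
theorem Code.config_injective {e : Z → ℝ} {z₀ : Z} : Injective (Code.config (e := e) (z₀ := z₀)) := by
  rintro ⟨⟨k, x⟩, hp⟩ ⟨⟨k', x'⟩, hp'⟩ h
  have hpts : Code.points (k, x) = Code.points (k', x') := congrArg Config.carrier h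
  have hr : ∀ n, (range fun i : Fin (k n) => x n i) = range fun i : Fin (k' n) => x' n i := fun n => by
    have := Code.points_inter_shell hp n
    rw [hpts, Code.points_inter_shell hp' n] at this
    exact this.symm
  have hre : ∀ n, (range fun i : Fin (k n) => e (x n i)) = range fun i : Fin (k' n) => e (x' n i) :=
    fun n => by
      have := congrArg (image e) (hr n)
      rwa [← range_comp, ← range_comp] at this
  have hk : k = k' := by
    funext n
    have h1 := Set.ncard_range_of_injective (Code.strictMono hp n).injective
    have h2 := Set.ncard_range_of_injective (Code.strictMono hp' n).injective
    have := (congrArg Set.ncard (hre n))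
    simp only [Nat.card_fin] at h1 h2
    exact h1.symm.trans (this.trans h2)
  subst hk
  have hx : x = x' := by
    funext n i
    by_cases hi : i < k n
    -- Two increasing enumerations of one set of reals agree. As `e` is not assumed injective here,
    -- the point `x n i` is first located in the list `x'`, at some `j`; strict monotonicity along
    -- `x'` then forces `j = i`.
    · have h1 := (StrictMono.range_inj (Code.strictMono hp n) (Code.strictMono hp' n)).1 (hre n)
      obtain ⟨j, hj⟩ : x n i ∈ range fun i : Fin (k n) => x' n i := hr n ▸ ⟨⟨i, hi⟩, rfl⟩
      have h2 : e (x' n j) = e (x' n i) := (congrArg e hj).trans (congrFun h1 ⟨i, hi⟩)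
      have h3 := (Code.strictMono hp' n).injective (a₁ := j) (a₂ := ⟨i, hi⟩) h2
      rw [← hj, h3]
    · exact ((hp n i).2 (not_lt.1 hi)).trans ((hp' n i).2 (not_lt.1 hi)).symm
  subst hx
  rfl

/-- Each shell contains finitely many points of a configuration; sorting their `e`-values and
choosing preimages gives a code. Injectivity of `e` ensures that the chosen preimages exhaust the
points. -/
theorem Code.config_surjective {e : Z → ℝ} (he : Injective e) (z₀ : Z) :
    Surjective (Code.config (e := e) (z₀ := z₀)) := by
  classical
  intro ω
  let F : ℕ → Finset ℝ := fun n => ((ω.finite_inter_shell n).image e).toFinset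
  have hF : ∀ n (i : Fin (F n).card), ∃ z, (z ∈ ω ∧ z ∈ shell Z n) ∧
      e z = (F n).orderEmbOfFin rfl i := fun n i => by
    have := (F n).orderEmbOfFin_mem rfl i
    rw [Finite.mem_toFinset] at this
    exact this
  choose y hy hye using hF
  let p : (ℕ → ℕ) × (ℕ → ℕ → Z) :=
    (fun n => (F n).card, fun n i => if h : i < (F n).card then y n ⟨i, h⟩ else z₀)
  have hlt : ∀ n i (h : i < (F n).card), p.2 n i = y n ⟨i, h⟩ := fun n i h => dif_pos h
  have hp : p ∈ Code e z₀ := by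
    refine fun n i => ⟨fun hi => ⟨?_, fun j hj => ?_⟩, fun hi => dif_neg (not_lt.2 hi)⟩
    · rw [hlt n i hi]
      exact (hy n _).2
    · rw [hlt n i hi, hlt n j (hj.trans hi), hye, hye]
      exact ((F n).orderEmbOfFin rfl).strictMono hj
  refine ⟨⟨p, hp⟩, SetLike.coe_injective (Set.ext fun z => ⟨?_, fun hz => ?_⟩)⟩
  · rintro ⟨n, i, hi, rfl⟩
    rw [hlt n i hi]
    exact (hy n _).1
  · obtain ⟨n, hn⟩ := exists_mem_shell z
    have hez : e z ∈ F n := (Finite.mem_toFinset _).2 ⟨z, ⟨hz, hn⟩, rfl⟩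
    have : e z ∈ range ((F n).orderEmbOfFin rfl) := by
      rw [Finset.range_orderEmbOfFin]; exact hez
    obtain ⟨i, hi⟩ := this
    refine ⟨n, i, i.2, ?_⟩
    rw [hlt n i i.2]
    exact he ((hye n i).trans hi)

omit [BorelSpace Z] in
-- Different valid indices list different points: within a shell because `e` increases strictly,
-- across shells because these are disjoint. A point count is therefore a double series of
-- indicators of conditions on single entries.
theorem Code.measurable_config {e : Z → ℝ} {z₀ : Z} :
    Measurable (Code.config (e := e) (z₀ := z₀)) := by
  classical
  refine Config.measurable_of_count fun U hU => measurable_of_toENNReal ?_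
  have hf : Measurable fun p : (ℕ → ℕ) × (ℕ → ℕ → Z) =>
      ∑' n, ∑' i, if i < p.1 n ∧ p.2 n i ∈ U then (1 : ℝ≥0∞) else 0 := by
    refine Measurable.tsum fun n => Measurable.tsum fun i => ?_
    have hk : MeasurableSet {p : (ℕ → ℕ) × (ℕ → ℕ → Z) | i < p.1 n} :=
      measurableSet_lt measurable_const (by fun_prop)
    have hx : Measurable fun p : (ℕ → ℕ) × (ℕ → ℕ → Z) => p.2 n i := by fun_prop
    exact Measurable.ite (hk.inter (hx hU)) measurable_const measurable_const
  refine (congrArg Measurable (funext fun p => ?_)).mp (hf.comp measurable_subtype_coe)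
  obtain ⟨p, hp⟩ := p
  let f : ℕ → ℕ → Set Z := fun n i => {z | (i < p.1 n ∧ p.2 n i ∈ U) ∧ z = p.2 n i}
  have hU' : ((Code.config ⟨p, hp⟩ : Config Z) : Set Z) ∩ U = ⋃ n, ⋃ i, f n i := by
    ext z
    simp only [mem_iUnion]
    constructor
    · rintro ⟨⟨n, i, hi, rfl⟩, hz⟩
      exact ⟨n, i, ⟨hi, hz⟩, rfl⟩
    · rintro ⟨n, i, ⟨hi, hz⟩, rfl⟩
      exact ⟨⟨n, i, hi, rfl⟩, hz⟩
  have h1 : ∀ n, Pairwise (Disjoint on f n) := by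
    intro n i j hij
    rw [Function.onFun, Set.disjoint_left]
    rintro z ⟨⟨hi, _⟩, rfl⟩ ⟨⟨hj, _⟩, h⟩
    have := (Code.strictMono hp n).injective (a₁ := ⟨i, hi⟩) (a₂ := ⟨j, hj⟩) (congrArg e h)
    exact hij (congrArg Fin.val this)
  have h2 : Pairwise (Disjoint on fun n => ⋃ i, f n i) := by
    intro m n hmn
    rw [Function.onFun, Set.disjoint_left]
    intro z hm hn
    obtain ⟨i, ⟨hi, _⟩, rfl⟩ := mem_iUnion.1 hm
    obtain ⟨j, ⟨hj, _⟩, h⟩ := mem_iUnion.1 hn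
    exact hmn (eq_of_mem_shell ((hp m i).1 hi).1 (h ▸ ((hp n j).1 hj).1))
  rw [Config.count, hU', encard_iUnion_eq_tsum h2]
  symm
  refine tsum_congr fun n => ?_
  rw [encard_iUnion_eq_tsum (h1 n)]
  refine tsum_congr fun i => ?_
  split_ifs with h
  · have : f n i = {p.2 n i} := by ext z; simp [f, h]
    simp [this]
  · have : f n i = ∅ := by ext z; simp only [f, h]; simp
    simp [this]

/-- By Lusin–Souslin, the injective measurable map `Code.config` from a standard Borel space into a
countably separated one is a measurable embedding, and it is onto. -/
instance : StandardBorelSpace (Config Z) := by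
  have := standardBorelSpace_of_locallyCompact (Z := Z)
  -- Codes need a filler point `z₀`, so the empty space is treated apart.
  rcases isEmpty_or_nonempty Z with hZ | ⟨⟨z₀⟩⟩
  · have : Subsingleton (Config Z) := ⟨fun ω η => SetLike.coe_injective (Subsingleton.elim _ _)⟩
    have : DiscreteMeasurableSpace (Config Z) :=
      ⟨fun s => (s.subsingleton_of_subsingleton).measurableSet⟩
    infer_instance
  · have he := measurableEmbedding_embeddingReal Z
    have := (measurableSet_code he.measurable z₀).standardBorel
    have hemb := Code.measurable_config.measurableEmbedding
      (Code.config_injective (e := embeddingReal Z) (z₀ := z₀))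
    have huniv := (Code.config_surjective he.injective z₀).range_eq
    exact StandardBorelSpace.of_measurableEquiv
      ((MeasurableEquiv.Set.univ _).symm.trans
        ((MeasurableEquiv.cast (congrArg (↥) huniv.symm) (by rw [huniv])).trans hemb.equivRange.symm))

end StandardBorel

section

/-! ### Measurability of membership -/

section Membership

variable {Z : Type*} [TopologicalSpace Z] [LocallyCompactSpace Z] [SecondCountableTopology Z]
  [T2Space Z] [MeasurableSpace Z] [BorelSpace Z]

/-- Membership means that the number of points of the configuration lying on the diagonal over `z`
is at least one. -/
theorem measurableSet_mem : MeasurableSet {p : Config Z × Z | p.2 ∈ p.1} := by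
  have hS : MeasurableSet {q : (Config Z × Z) × Z | q.2 = q.1.2} :=
    measurableSet_eq_fun measurable_snd measurable_fst.snd
  have h := measurable_encard_points (f := fun p : Config Z × Z => p.1) measurable_fst hS
  convert h (MeasurableSet.of_discrete (s := Ici (1 : ℕ∞))) using 1
  ext p
  rw [mem_preimage, mem_Ici, one_le_encard_iff_nonempty]
  exact ⟨fun hp => ⟨p.2, hp, rfl⟩, fun ⟨z, hz, e⟩ => by obtain rfl : z = p.2 := e; exact hz⟩

theorem measurableSet_mem_comp {α : Type*} [MeasurableSpace α] {f : α → Config Z} {x : α → Z}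
    (hf : Measurable f) (hx : Measurable x) : MeasurableSet {a | x a ∈ f a} :=
  (hf.prodMk hx) measurableSet_mem

omit [LocallyCompactSpace Z] in
theorem lintegral_pointKernel (ω : Config Z) (F : Z → ℝ≥0∞) :
    ∫⁻ z, F z ∂pointKernel Z ω = ∑' z : ω, F z := by
  change ∫⁻ z in (ω : Set Z), F z ∂Measure.count = _
  rw [lintegral_countable _ ω.countable]
  simp only [Measure.count_singleton, mul_one]
  rfl

theorem lintegral_pointKernel_indicator (ω : Config Z) {S : Set Z} (hS : MeasurableSet S) :
    ∫⁻ z, S.indicator 1 z ∂pointKernel Z ω = ({z | z ∈ ω ∧ z ∈ S}.encard : ℝ≥0∞) := by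
  rw [lintegral_indicator_one hS, pointKernel_apply]
  rfl

end Membership

variable {G : Type*} [Group G] [TopologicalSpace G] [IsTopologicalGroup G]
  [LocallyCompactSpace G] [SecondCountableTopology G] [T2Space G] [MeasurableSpace G] [BorelSpace G]

instance : MeasurableConstSMul G (Config G) where
  measurable_const_smul g := by
    have := (measurable_inv_smul (G := G)).comp (measurable_id.prodMk (measurable_const (a := g⁻¹)))
    simpa [Function.comp_def] using this

theorem pointKernel_smul (g : G) (ω : Config G) :
    pointKernel G (g • ω) = (pointKernel G ω).map (g * ·) := by
  ext V hV
  rw [Measure.map_apply (measurable_const_mul g) hV, pointKernel_apply, pointKernel_apply,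
    ← (mul_right_injective g).encard_image ((ω : Set G) ∩ _), image_inter_preimage]
  rfl

theorem lintegral_pointKernel_smul (g : G) (ω : Config G) {F : G → ℝ≥0∞} (hF : Measurable F) :
    ∫⁻ x, F x ∂pointKernel G (g • ω) = ∫⁻ x, F (g * x) ∂pointKernel G ω := by
  rw [pointKernel_smul, lintegral_map hF (measurable_const_mul g)]

/-- The configuration underlying a rooted configuration. -/
def Rooted.config (ω : Rooted G) : Config G := ω.1

omit [IsTopologicalGroup G] in
theorem measurableSet_rooted : MeasurableSet {ω : Config G | (1 : G) ∈ ω} :=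
  measurableSet_mem_comp measurable_id measurable_const

omit [IsTopologicalGroup G] in
theorem measurableEmbedding_rooted : MeasurableEmbedding (Rooted.config (G := G)) :=
  MeasurableEmbedding.subtype_coe measurableSet_rooted

omit [IsTopologicalGroup G] in
theorem measurableSet_arrow : MeasurableSet {p : Rooted G × G | p.2 ∈ p.1.1} :=
  measurableSet_mem_comp (measurable_subtype_coe.comp measurable_fst) measurable_snd

omit [IsTopologicalGroup G] in
-- Lets Borel sets of arrows be handled as Borel sets of `Config G × G`, where rerooting is defined
-- at every group element without a membership proof.
theorem measurableEmbedding_arrow :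
    MeasurableEmbedding fun a : Arrow G => ((a.1.1.1, a.1.2) : Config G × G) :=
  (measurableEmbedding_rooted.prodMap MeasurableEmbedding.id).comp
    (MeasurableEmbedding.subtype_coe measurableSet_arrow)

/-! ### The rerooting groupoid is Borel and `r`-discrete -/

omit [LocallyCompactSpace G] [T2Space G] [MeasurableSpace G] [BorelSpace G] in
theorem countable_source_fiber (ω : Rooted G) :
    ((rerootingGroupoid G).source ⁻¹' {ω}).Countable := by
  refine MapsTo.countable_of_injOn (f := fun a : Arrow G => a.1.2) (t := (ω.1 : Set G)) ?_ ?_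
    ω.1.countable
  · rintro a rfl
    exact a.2
  · rintro a ha b hb hab
    exact Arrow.ext' (Eq.trans ha (Eq.symm hb)) hab

omit [LocallyCompactSpace G] [SecondCountableTopology G] [T2Space G] [MeasurableSpace G]
  [BorelSpace G] in
theorem rerooting_inv_inv (a : Arrow G) :
    (rerootingGroupoid G).inv ((rerootingGroupoid G).inv a) = a :=
  Arrow.ext' ((rerootingGroupoid G).target_inv a) (inv_inv _)

variable (G) in
theorem rerootingGroupoid_isRDiscrete : (rerootingGroupoid G).IsRDiscrete := by
  have hu : StandardBorelSpace (Rooted G) := measurableSet_rooted.standardBorel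
  have hG : StandardBorelSpace G := standardBorelSpace_of_locallyCompact
  refine ⟨hu, measurableSet_arrow.standardBorel, measurable_fst.comp measurable_subtype_coe,
    measurable_rerooting_target, Measurable.subtype_mk (measurable_id.prodMk measurable_const),
    measurable_rerooting_inv, ?_, countable_source_fiber, fun ω => ?_⟩
  · refine Measurable.subtype_mk (Measurable.prodMk ?_ (Measurable.mul ?_ ?_))
    · exact measurable_fst.comp (measurable_subtype_coe.comp
        (measurable_fst.comp measurable_subtype_coe))
    · exact measurable_snd.comp (measurable_subtype_coe.comp
        (measurable_fst.comp measurable_subtype_coe))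
    · exact measurable_snd.comp (measurable_subtype_coe.comp
        (measurable_snd.comp measurable_subtype_coe))
  -- Inversion carries the target fibre injectively into the source fibre.
  · refine MapsTo.countable_of_injOn (f := (rerootingGroupoid G).inv) ?_ ?_
      (countable_source_fiber ω)
    · exact fun a ha => ha
    · exact (LeftInverse.injective rerooting_inv_inv).injOn

/-! ### The Campbell measure -/

omit [T2Space G] in
/-- An s-finite left invariant measure is `σ`-finite if it is finite on some set of positive Haar
measure. -/
theorem sigmaFinite_of_isMulLeftInvariant (haar ν : Measure G) [haar.IsHaarMeasure] [SFinite ν]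
    [ν.IsMulLeftInvariant] {U : Set G} (hU : MeasurableSet U) (hU0 : haar U ≠ 0)
    (hν : ν U ≠ ∞) : SigmaFinite ν := by
  -- A strictly positive function with finite `ν`-integral suffices. From a strictly positive `f`
  -- with finite Haar integral, the Fubini identity `h` expresses `ν U * ∫⁻ x, f x ∂haar` as the
  -- `ν`-integral of `k`, and `k` vanishes nowhere because right translates of `U` have positive
  -- Haar measure. The superlevel sets of `k` then exhaust `G`.
  obtain ⟨f, hf0, hf, hf1⟩ := exists_pos_lintegral_lt_of_sigmaFinite haar one_ne_zero
  have hfm : Measurable fun x => (f x : ℝ≥0∞) := hf.coe_nnreal_ennreal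
  have h := measure_mul_lintegral_eq ν haar hU (fun x => (f x : ℝ≥0∞)) hfm
  set k : G → ℝ≥0∞ := fun x => haar ((fun z => z * x) ⁻¹' U) * f x⁻¹
  have hk : Measurable k := (measurable_measure_mul_right haar hU).mul (hfm.comp measurable_inv)
  have hk0 : ∀ x, k x ≠ 0 := fun x =>
    mul_ne_zero (measure_mul_right_ne_zero haar hU0 x) (by simpa using (hf0 x⁻¹).ne')
  have hkfin : ∫⁻ x, k x ∂ν ≠ ∞ := by
    rw [← h]
    exact ENNReal.mul_ne_top hν (hf1.trans ENNReal.one_lt_top).ne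
  refine ⟨⟨⟨fun n => {x | ((n : ℝ≥0∞) + 1)⁻¹ ≤ k x}, fun _ => trivial, fun n => ?_, ?_⟩⟩⟩
  · refine (meas_ge_le_lintegral_div hk.aemeasurable ?_ ?_).trans_lt ?_
    · simp
    · simp
    · exact ENNReal.div_lt_top hkfin (by simp)
  · refine eq_univ_of_forall fun x => mem_iUnion.2 ?_
    obtain ⟨n, hn⟩ := ENNReal.exists_inv_nat_lt (hk0 x)
    exact ⟨n, (ENNReal.inv_le_inv.2 le_self_add).trans hn.le⟩

/-- The Campbell measure of `μ`: the expected number of points `g` of `ω` for which `(g, g⁻¹ω)` lies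
in a given set. -/
noncomputable def campbell (μ : Measure (Config G)) : Measure (G × Config G) :=
  (μ ⊗ₘ pointKernel G).map fun p => (p.2, p.2⁻¹ • p.1)

theorem measurable_campbell_map : Measurable fun p : Config G × G => (p.2, p.2⁻¹ • p.1) :=
  measurable_snd.prodMk measurable_inv_smul

theorem lintegral_campbell (μ : Measure (Config G)) [SFinite μ] {F : G × Config G → ℝ≥0∞}
    (hF : Measurable F) :
    ∫⁻ p, F p ∂campbell μ = ∫⁻ ω, ∫⁻ g, F (g, g⁻¹ • ω) ∂pointKernel G ω ∂μ := by
  rw [campbell, lintegral_map hF measurable_campbell_map,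
    Measure.lintegral_compProd (f := fun p => F (p.2, p.2⁻¹ • p.1))
      (hF.comp measurable_campbell_map)]

theorem campbell_prod (μ : Measure (Config G)) [SFinite μ] {V : Set G} (hV : MeasurableSet V)
    {A : Set (Config G)} (hA : MeasurableSet A) :
    campbell μ (V ×ˢ A) = ∫⁻ ω, ({g | g ∈ ω ∧ g ∈ V ∧ g⁻¹ • ω ∈ A}.encard : ℝ≥0∞) ∂μ := by
  rw [← lintegral_indicator_one (hV.prod hA),
    lintegral_campbell μ (measurable_one.indicator (hV.prod hA))]
  refine lintegral_congr fun ω => ?_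
  have hS : MeasurableSet {g : G | g ∈ V ∧ g⁻¹ • ω ∈ A} :=
    (measurable_campbell_map.comp measurable_prodMk_left) (hV.prod hA)
  exact lintegral_pointKernel_indicator ω hS

/-- With `A` fixed, the measure `ν` in the variable `V` inherits left invariance from `μ`;
uniqueness of Haar measure makes it a multiple of `haar`, and the constant is found by evaluating at
`U`. -/
theorem campbell_prod_eq (haar : Measure G) [haar.IsHaarMeasure] (μ : Measure (Config G))
    [SFinite μ] [SMulInvariantMeasure G (Config G) μ] {U : Set G}
    (hU : MeasurableSet U) (hU0 : haar U ≠ 0) (hUtop : haar U ≠ ∞)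
    (hfin : campbell μ (U ×ˢ univ) ≠ ∞) {A : Set (Config G)} (hA : MeasurableSet A) {V : Set G}
    (hV : MeasurableSet V) :
    campbell μ (V ×ˢ A) = campbell μ (U ×ˢ A) / haar U * haar V := by
  have : SFinite (campbell μ) := by unfold campbell; infer_instance
  let ν : Measure G := ((campbell μ).restrict (univ ×ˢ A)).map Prod.fst
  have hν : ∀ W, MeasurableSet W → ν W = campbell μ (W ×ˢ A) := fun W hW => by
    rw [Measure.map_apply measurable_fst hW, Measure.restrict_apply (measurable_fst hW)]
    congr 1
    ext p
    simp
  have hinv : ν.IsMulLeftInvariant := by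
    refine ⟨fun g => Measure.ext fun W hW => ?_⟩
    have hgW := measurable_const_mul g hW
    rw [Measure.map_apply (measurable_const_mul g) hW, hν _ hgW, hν _ hW, campbell_prod μ hgW hA,
      campbell_prod μ hW hA]
    have hS : MeasurableSet {p : Config G × G | p.2 ∈ W ∧ p.2⁻¹ • p.1 ∈ A} :=
      measurable_campbell_map (hW.prod hA)
    refine Eq.trans ?_ ((measurePreserving_smul g μ).lintegral_comp (measurable_toENNReal.comp
      (measurable_encard_points measurable_id hS)))
    refine lintegral_congr fun ω => ?_
    -- Multiplication by `g` matches the points `y` of `ω` with those of `g • ω`, and rerooting `g •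
    -- ω` at `g * y` gives the same configuration as rerooting `ω` at `y`.
    rw [← (mul_right_injective g).encard_image]
    congr 2
    ext x
    constructor
    · rintro ⟨y, ⟨hy, hyW, hyA⟩, rfl⟩
      exact ⟨⟨y, hy, rfl⟩, hyW, by simpa [mul_smul] using hyA⟩
    · rintro ⟨⟨y, hy, rfl⟩, hyW, hyA⟩
      exact ⟨y, ⟨hy, hyW, by simpa [mul_smul] using hyA⟩, rfl⟩
  -- Finiteness is known only on `U`, which need not be a neighbourhood of any point, so
  -- `σ`-finiteness has to come from invariance before uniqueness can be applied.
  have : SigmaFinite ν := sigmaFinite_of_isMulLeftInvariant haar ν hU hU0 (by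
    rw [hν U hU]
    exact ne_top_of_le_ne_top hfin (measure_mono (prod_mono_right (subset_univ A))))
  have h := congrArg (· V) (measure_eq_div_smul ν haar hU0 hUtop)
  simpa [hν V hV, hν U hU] using h

theorem intensity_eq_campbell (haar : Measure G) (μ : Measure (Config G)) [SFinite μ]
    {V : Set G} (hV : MeasurableSet V) :
    intensity haar μ V = campbell μ (V ×ˢ univ) / haar V := by
  rw [campbell_prod μ hV MeasurableSet.univ]
  simp only [mem_univ, and_true]
  rfl

theorem palmMeasure_preimage (haar : Measure G) (μ : Measure (Config G)) [SFinite μ]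
    {V : Set G} (hV : MeasurableSet V) {A : Set (Config G)}
    (hA : MeasurableSet A) :
    palmMeasure haar μ V hV (Rooted.config ⁻¹' A) =
      (intensity haar μ V)⁻¹ * (campbell μ (V ×ˢ A) / haar V) := by
  rw [palmMeasure, Measure.ofMeasurable_apply _ (measurableEmbedding_rooted.measurable hA), campbell_prod μ hV hA]
  congr 3
  ext ω
  rw [rerootCount]
  congr 2
  ext g
  exact ⟨fun ⟨hg, h, hA⟩ => ⟨h, hg, hA⟩, fun ⟨h, hg, hA⟩ => ⟨hg, h, hA⟩⟩

theorem isProbabilityMeasure_palmMeasure (haar : Measure G) (μ : Measure (Config G)) [SFinite μ]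
    {U : Set G} (hU : MeasurableSet U) (hpos : intensity haar μ U ≠ 0)
    (hfin : intensity haar μ U ≠ ∞) : IsProbabilityMeasure (palmMeasure haar μ U hU) := by
  refine ⟨?_⟩
  have := palmMeasure_preimage haar μ hU MeasurableSet.univ
  rw [← intensity_eq_campbell haar μ hU, preimage_univ, ENNReal.inv_mul_cancel hpos hfin] at this
  exact this

/-! ### The refined Campbell theorem and transfer of null sets -/

section Palm

variable (haar : Measure G) [haar.IsHaarMeasure] (μ : Measure (Config G)) [SFinite μ]
  [SMulInvariantMeasure G (Config G) μ] {U : Set G}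

theorem intensity_palmMeasure_eq (hU : MeasurableSet U) (hU0 : haar U ≠ 0) (hUtop : haar U ≠ ∞)
    (hfin : intensity haar μ U ≠ ∞) {V : Set G} (hV : MeasurableSet V) (hV0 : haar V ≠ 0)
    (hVtop : haar V ≠ ∞) :
    intensity haar μ V = intensity haar μ U ∧ palmMeasure haar μ V hV = palmMeasure haar μ U hU := by
  have hfin' : campbell μ (U ×ˢ univ) ≠ ∞ := fun h => hfin (by
    rw [intensity_eq_campbell haar μ hU, h, ENNReal.top_div_of_ne_top hUtop])
  have key : ∀ A, MeasurableSet A → campbell μ (V ×ˢ A) / haar V = campbell μ (U ×ˢ A) / haar U :=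
    fun A hA => by
      rw [campbell_prod_eq haar μ hU hU0 hUtop hfin' hA hV, ENNReal.mul_div_cancel_right hV0 hVtop]
  have hint : intensity haar μ V = intensity haar μ U := by
    rw [intensity_eq_campbell haar μ hU, intensity_eq_campbell haar μ hV, key _ .univ]
  refine ⟨hint, Measure.ext fun S hS => ?_⟩
  obtain ⟨A, hA, rfl⟩ := hS
  exact (palmMeasure_preimage haar μ hV hA).trans
    ((by rw [hint, key A hA] : _ = _).trans (palmMeasure_preimage haar μ hU hA).symm)

/-- The refined Campbell theorem. -/
theorem campbell_eq_smul_prod (hU : MeasurableSet U) (hU0 : haar U ≠ 0) (hUtop : haar U ≠ ∞)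
    (hpos : intensity haar μ U ≠ 0) (hfin : intensity haar μ U ≠ ∞) :
    campbell μ =
      intensity haar μ U • haar.prod ((palmMeasure haar μ U hU).map Rooted.config) := by
  have := isProbabilityMeasure_palmMeasure haar μ hU hpos hfin
  have hfin' : campbell μ (U ×ˢ univ) ≠ ∞ := fun h => hfin (by
    rw [intensity_eq_campbell haar μ hU, h, ENNReal.top_div_of_ne_top hUtop])
  have h : haar.prod ((palmMeasure haar μ U hU).map Rooted.config) =
      (intensity haar μ U)⁻¹ • campbell μ := by
    -- Both factors of the product are `σ`-finite, so it is determined by its values on rectangles;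
    -- the intensity is moved to the Campbell side for this and cancelled afterwards.
    refine Measure.prod_eq fun V A hV hA => ?_
    rw [Measure.map_apply measurableEmbedding_rooted.measurable hA,
      palmMeasure_preimage haar μ hU hA, Measure.smul_apply, smul_eq_mul,
      campbell_prod_eq haar μ hU hU0 hUtop hfin' hA hV]
    ring
  rw [h, smul_smul, ENNReal.mul_inv_cancel hpos hfin, one_smul]

theorem lintegral_campbell_eq (hU : MeasurableSet U) (hU0 : haar U ≠ 0) (hUtop : haar U ≠ ∞)
    (hpos : intensity haar μ U ≠ 0) (hfin : intensity haar μ U ≠ ∞) {F : G × Config G → ℝ≥0∞}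
    (hF : Measurable F) :
    ∫⁻ p, F p ∂campbell μ =
      intensity haar μ U * ∫⁻ η, ∫⁻ g, F (g, η.1) ∂haar ∂palmMeasure haar μ U hU := by
  have := isProbabilityMeasure_palmMeasure haar μ hU hpos hfin
  rw [campbell_eq_smul_prod haar μ hU hU0 hUtop hpos hfin, lintegral_smul_measure,
    lintegral_prod_symm _ hF.aemeasurable, lintegral_map hF.lintegral_prod_left'
      measurableEmbedding_rooted.measurable]
  rfl

/-- Let `B` be the set of bad rooted configurations. Both sides say that `univ ×ˢ B` is
Campbell-null: by the product formula this means that `B` is Palm-null, and by definition that the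
expected number of points of `ω` with rerooting in `B` is zero. -/
theorem ae_palmMeasure_iff (hU : MeasurableSet U) (hU0 : haar U ≠ 0) (hUtop : haar U ≠ ∞)
    (hpos : intensity haar μ U ≠ 0) (hfin : intensity haar μ U ≠ ∞) {p : Rooted G → Prop}
    (hp : MeasurableSet {η | p η}) :
    (∀ᵐ η ∂palmMeasure haar μ U hU, p η) ↔ ∀ᵐ ω ∂μ, ∀ (g : G) (h : g ∈ ω), p (reroot ω g h) := by
  have := isProbabilityMeasure_palmMeasure haar μ hU hpos hfin
  let B : Set (Config G) := Rooted.config '' {η | ¬ p η}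
  have hB : MeasurableSet B := measurableEmbedding_rooted.measurableSet_image.2 hp.compl
  have hpB : ∀ η : Rooted G, ¬ p η ↔ η.config ∈ B := fun η =>
    (measurableEmbedding_rooted.injective.mem_set_image (s := {η | ¬ p η})).symm
  have h1 : (∀ᵐ η ∂palmMeasure haar μ U hU, p η) ↔ campbell μ (univ ×ˢ B) = 0 := by
    rw [campbell_eq_smul_prod haar μ hU hU0 hUtop hpos hfin, Measure.smul_apply, Measure.prod_prod,
      smul_eq_mul, mul_eq_zero, mul_eq_zero, or_iff_right hpos,
      or_iff_right (fun h => hU0 (measure_mono_null (subset_univ U) h)),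
      Measure.map_apply measurableEmbedding_rooted.measurable hB, ae_iff]
    simp_rw [hpB]
    rfl
  have hS : MeasurableSet {q : Config G × G | q.2 ∈ univ ∧ q.2⁻¹ • q.1 ∈ B} :=
    measurable_campbell_map (MeasurableSet.univ.prod hB)
  rw [h1, campbell_prod μ .univ hB]
  refine (lintegral_eq_zero_iff (measurable_toENNReal.comp
    (measurable_encard_points measurable_id hS))).trans ?_
  refine Filter.eventually_congr (Filter.Eventually.of_forall fun ω => ?_)
  simp only [Function.comp_apply, Pi.zero_apply, ENat.toENNReal_eq_zero, encard_eq_zero, eq_empty_iff_forall_notMem]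
  refine forall_congr' fun g => ⟨fun h hg => by_contra fun hn => h ⟨hg, trivial, ?_⟩, fun h hg => ?_⟩
  · exact (hpB (reroot ω g hg)).1 hn
  · exact (hpB (reroot ω g hg.1)).2 hg.2.2 (h hg.1)

/-! ### Unimodularity -/

/-- The mass transport principle. -/
theorem lintegral_palmMeasure_inv [haar.IsMulRightInvariant] (hU : MeasurableSet U)
    (hU0 : haar U ≠ 0) (hUtop : haar U ≠ ∞) (hpos : intensity haar μ U ≠ 0)
    (hfin : intensity haar μ U ≠ ∞) {f : Config G × G → ℝ≥0∞} (hf : Measurable f) :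
    ∫⁻ η, ∫⁻ k, f (k⁻¹ • η.1, k⁻¹) ∂pointKernel G η.1 ∂palmMeasure haar μ U hU =
      ∫⁻ η, ∫⁻ k, f (η.1, k) ∂pointKernel G η.1 ∂palmMeasure haar μ U hU := by
  let u : G → ℝ≥0∞ := U.indicator 1
  have hu : Measurable u := measurable_one.indicator hU
  have hku : ∫⁻ g, u g ∂haar = haar U := lintegral_indicator_one hU
  have hcm := measurable_inv_smul (G := G)
  -- Against the Campbell measure, both `F₁` and `F₂` integrate to the expectation of the sum over
  -- `g, h ∈ ω` of `u g * f (h⁻¹ • ω, h⁻¹ * g)`. They differ in which of the two points serves as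
  -- the root: `g` with `k = g⁻¹ * h` for `F₁`, and `h` with `k = h⁻¹ * g` for `F₂`.
  let F₁ : G × Config G → ℝ≥0∞ :=
    fun p => ∫⁻ k, u p.1 * f (k⁻¹ • p.2, k⁻¹) ∂pointKernel G p.2
  let F₂ : G × Config G → ℝ≥0∞ := fun p => ∫⁻ k, u (p.1 * k) * f (p.2, k) ∂pointKernel G p.2
  have hF₁ : Measurable F₁ := by
    refine Measurable.lintegral_kernel_prod_right' (κ := (pointKernel G).comap Prod.snd measurable_snd)
      (f := fun q : (G × Config G) × G => u q.1.1 * f (q.2⁻¹ • q.1.2, q.2⁻¹)) ?_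
    exact (hu.comp measurable_fst.fst).mul (hf.comp
      ((hcm.comp (measurable_fst.snd.prodMk measurable_snd)).prodMk measurable_snd.inv))
  have hF₂ : Measurable F₂ := by
    refine Measurable.lintegral_kernel_prod_right' (κ := (pointKernel G).comap Prod.snd measurable_snd)
      (f := fun q : (G × Config G) × G => u (q.1.1 * q.2) * f (q.1.2, q.2)) ?_
    exact (hu.comp (measurable_fst.fst.mul measurable_snd)).mul (hf.comp
      (measurable_fst.snd.prodMk measurable_snd))
  have hf₁ : ∀ η : Config G, Measurable fun k : G => f (k⁻¹ • η, k⁻¹) := fun η =>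
    hf.comp ((hcm.comp (measurable_const.prodMk measurable_id)).prodMk measurable_inv)
  have hf₂ : ∀ η : Config G, Measurable fun k : G => f (η, k) := fun η =>
    hf.comp (measurable_const.prodMk measurable_id)
  have key : ∫⁻ p, F₁ p ∂campbell μ = ∫⁻ p, F₂ p ∂campbell μ := by
    rw [lintegral_campbell μ hF₁, lintegral_campbell μ hF₂]
    refine lintegral_congr fun ω => ?_
    have h1 : ∀ g, F₁ (g, g⁻¹ • ω) = ∫⁻ h, u g * f (h⁻¹ • ω, h⁻¹ * g) ∂pointKernel G ω := fun g => by
      change ∫⁻ k, u g * f (k⁻¹ • g⁻¹ • ω, k⁻¹) ∂pointKernel G (g⁻¹ • ω) = _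
      rw [lintegral_pointKernel_smul _ _ ((hf₁ (g⁻¹ • ω)).const_mul (u g))]
      refine lintegral_congr fun h => ?_
      simp [smul_smul]
    have h2 : ∀ h, F₂ (h, h⁻¹ • ω) = ∫⁻ g, u g * f (h⁻¹ • ω, h⁻¹ * g) ∂pointKernel G ω := fun h => by
      change ∫⁻ k, u (h * k) * f (h⁻¹ • ω, k) ∂pointKernel G (h⁻¹ • ω) = _
      have hm : Measurable fun k => u (h * k) * f (h⁻¹ • ω, k) :=
        (hu.comp (measurable_const_mul h)).mul (hf₂ (h⁻¹ • ω))
      rw [lintegral_pointKernel_smul _ _ hm]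
      simp
    simp_rw [h1, h2]
    refine lintegral_lintegral_swap (Measurable.aemeasurable ?_)
    exact (hu.comp measurable_fst).mul (hf.comp ((hcm.comp
      (measurable_const.prodMk measurable_snd)).prodMk (measurable_snd.inv.mul measurable_fst)))
  rw [lintegral_campbell_eq haar μ hU hU0 hUtop hpos hfin hF₁,
    lintegral_campbell_eq haar μ hU hU0 hUtop hpos hfin hF₂,
    ENNReal.mul_right_inj hpos hfin] at key
  have h1 : ∀ η : Rooted G, ∫⁻ g, F₁ (g, η.1) ∂haar =
      haar U * ∫⁻ k, f (k⁻¹ • η.1, k⁻¹) ∂pointKernel G η.1 := fun η => by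
    have : ∀ g, F₁ (g, η.1) = u g * ∫⁻ k, f (k⁻¹ • η.1, k⁻¹) ∂pointKernel G η.1 := fun g =>
      lintegral_const_mul _ (hf₁ η.1)
    simp_rw [this]
    rw [lintegral_mul_const _ hu, hku]
  -- Here unimodularity enters: the translate `g ↦ u (g * k)` has the same Haar integral as `u`.
  have h2 : ∀ η : Rooted G, ∫⁻ g, F₂ (g, η.1) ∂haar =
      haar U * ∫⁻ k, f (η.1, k) ∂pointKernel G η.1 := fun η => by
    rw [← lintegral_const_mul _ (hf₂ η.1)]
    have hm : Measurable (uncurry fun g k => u (g * k) * f (η.1, k)) :=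
      (hu.comp (measurable_fst.mul measurable_snd)).mul ((hf₂ η.1).comp measurable_snd)
    refine (lintegral_lintegral_swap (μ := haar) (ν := pointKernel G η.1) hm.aemeasurable).trans
      (lintegral_congr fun k => ?_)
    exact (lintegral_mul_const _ (hu.comp (measurable_mul_const k))).trans
      (congrArg (· * f (η.1, k)) ((lintegral_mul_right_eq_self u k).trans hku))
  simp_rw [h1, h2] at key
  rwa [lintegral_const_mul' _ _ hUtop, lintegral_const_mul' _ _ hUtop,
    ENNReal.mul_right_inj hU0 hUtop] at key

/-- Puts fibre counts into the form to which the mass transport principle applies. -/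
theorem lintegral_source_fiber {S : Set (Arrow G)} (hS : MeasurableSet S) (η : Rooted G) :
    (((rerootingGroupoid G).source ⁻¹' {η} ∩ S).encard : ℝ≥0∞) =
      ∫⁻ k, ((fun a : Arrow G => ((a.1.1.1, a.1.2) : Config G × G)) '' S).indicator 1 (η.1, k)
        ∂pointKernel G η.1 := by
  have hT := measurableEmbedding_arrow.measurableSet_image.2 hS
  refine Eq.trans ?_ (lintegral_pointKernel_indicator η.1 (measurable_prodMk_left hT)).symm
  have hinj : InjOn (fun a : Arrow G => a.1.2) ((rerootingGroupoid G).source ⁻¹' {η} ∩ S) := by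
    rintro a ⟨ha, _⟩ b ⟨hb, _⟩ hab
    exact Arrow.ext' (Eq.trans ha (Eq.symm hb)) hab
  rw [← hinj.encard_image]
  congr 2
  ext k
  constructor
  · rintro ⟨a, ⟨rfl, ha⟩, rfl⟩
    exact ⟨a.2, a, ha, rfl⟩
  · rintro ⟨_, a, ha, hak⟩
    obtain ⟨h1, h2⟩ := Prod.ext_iff.1 hak
    exact ⟨a, ⟨Rooted.ext' h1, ha⟩, h2⟩

theorem sourceMeasure_apply (m : Measure (Rooted G)) {S : Set (Arrow G)} (hS : MeasurableSet S) :
    sourceMeasure m S = ∫⁻ η, (((rerootingGroupoid G).source ⁻¹' {η} ∩ S).encard : ℝ≥0∞) ∂m := by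
  rw [sourceMeasure, fiberMeasure, Measure.ofMeasurable_apply _ hS]

theorem targetMeasure_apply (m : Measure (Rooted G)) {S : Set (Arrow G)} (hS : MeasurableSet S) :
    targetMeasure m S = ∫⁻ η, (((rerootingGroupoid G).target ⁻¹' {η} ∩ S).encard : ℝ≥0∞) ∂m := by
  rw [targetMeasure, fiberMeasure, Measure.ofMeasurable_apply _ hS]

omit [LocallyCompactSpace G] [SecondCountableTopology G] [T2Space G] [MeasurableSpace G]
  [BorelSpace G] in
theorem encard_target_fiber (S : Set (Arrow G)) (η : Rooted G) :
    ((rerootingGroupoid G).target ⁻¹' {η} ∩ S).encard =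
      ((rerootingGroupoid G).source ⁻¹' {η} ∩ (rerootingGroupoid G).inv ⁻¹' S).encard := by
  rw [← (LeftInverse.injective rerooting_inv_inv).encard_image]
  congr 1
  ext a
  constructor
  · rintro ⟨b, ⟨hb, hbS⟩, rfl⟩
    exact ⟨hb, by rwa [mem_preimage, rerooting_inv_inv]⟩
  · rintro ⟨ha, haS⟩
    exact ⟨_, ⟨((rerootingGroupoid G).target_inv a).trans ha, haS⟩, rerooting_inv_inv a⟩

/-- Inversion exchanges source and target fibres, so the claim is that the source measure is
invariant under inversion. This is mass transport for the indicator of `S`. -/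
theorem sourceMeasure_eq_targetMeasure [haar.IsMulRightInvariant] (hU : MeasurableSet U)
    (hU0 : haar U ≠ 0) (hUtop : haar U ≠ ∞) (hpos : intensity haar μ U ≠ 0)
    (hfin : intensity haar μ U ≠ ∞) :
    sourceMeasure (palmMeasure haar μ U hU) = targetMeasure (palmMeasure haar μ U hU) := by
  refine Measure.ext fun S hS => ?_
  rw [sourceMeasure_apply _ hS, targetMeasure_apply _ hS]
  simp_rw [encard_target_fiber, lintegral_source_fiber hS,
    lintegral_source_fiber (measurable_rerooting_inv hS)]
  rw [← lintegral_palmMeasure_inv haar μ hU hU0 hUtop hpos hfin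
    (measurable_one.indicator (measurableEmbedding_arrow.measurableSet_image.2 hS))]
  refine lintegral_congr fun η => ?_
  -- Sums over the points of `η` make `k ∈ η` available, without which `(η, k)` is not an arrow.
  rw [lintegral_pointKernel, lintegral_pointKernel]
  refine tsum_congr fun ⟨k, hk⟩ => ?_
  refine indicator_eq_indicator ?_ rfl
  let a : Arrow G := ⟨(η, k), hk⟩
  constructor
  · rintro ⟨b, hb, hbk⟩
    obtain ⟨h1, h2⟩ := Prod.ext_iff.1 hbk
    have : b = (rerootingGroupoid G).inv a := Arrow.ext' (Rooted.ext' h1) h2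
    exact ⟨a, by rwa [mem_preimage, ← this], rfl⟩
  · rintro ⟨b, hb, hbk⟩
    obtain ⟨h1, h2⟩ := Prod.ext_iff.1 hbk
    obtain rfl : b = a := Arrow.ext' (Rooted.ext' h1) h2
    exact ⟨_, hb, rfl⟩

theorem ae_sourceMeasure_iff (m : Measure (Rooted G)) {p : Arrow G → Prop}
    (hp : MeasurableSet {a | p a}) :
    (∀ᵐ a ∂sourceMeasure m, p a) ↔ ∀ᵐ η ∂m, ∀ (k : G) (hk : k ∈ η.1), p ⟨(η, k), hk⟩ := by
  rw [ae_iff]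
  change sourceMeasure m {a | p a}ᶜ = 0 ↔ _
  rw [sourceMeasure_apply m hp.compl]
  refine (lintegral_eq_zero_iff
    (measurable_toENNReal.comp (measurable_source_fiber hp.compl))).trans ?_
  refine Filter.eventually_congr (Filter.Eventually.of_forall fun η => ?_)
  simp only [Function.comp_apply, Pi.zero_apply, ENat.toENNReal_eq_zero, encard_eq_zero, eq_empty_iff_forall_notMem]
  constructor
  · exact fun h k hk => by_contra fun hn => h ⟨(η, k), hk⟩ ⟨rfl, hn⟩
  · rintro h a ⟨rfl, ha⟩
    exact ha (h _ a.2)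

end Palm

end

/-! ### Formal reduction of the correspondences and equivariance of rerooting -/

section

/-- Since `H ∘ F` is the identity almost everywhere, compatibility of `F` with the equivalences
follows from that of `H`. In each application the map `H` builds a factor from a root object. -/
theorem IsCorrespondence.of_congr_inverse {Ω X β : Type*} [MeasurableSpace Ω] {μ : Measure Ω}
    {P : (Ω → X) → Prop} {Q : β → Prop} {s : β → β → Prop} {F : (Ω → X) → β} {H : β → Ω → X}
    (mapsTo : ∀ a, P a → Q (F a)) (mapsTo' : ∀ b, Q b → P (H b))
    (congr' : ∀ b b', Q b → Q b' → (s b b' ↔ H b =ᵐ[μ] H b'))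
    (left_inv : ∀ a, P a → H (F a) =ᵐ[μ] a) (right_inv : ∀ b, F (H b) = b) (refl : ∀ b, s b b) :
    IsCorrespondence P (fun a a' => a =ᵐ[μ] a') Q s F H where
  mapsTo := mapsTo
  mapsTo' := mapsTo'
  congr a a' ha ha' := by
    rw [congr' _ _ (mapsTo a ha) (mapsTo a' ha')]
    exact ⟨fun h => (left_inv a ha).trans (h.trans (left_inv a' ha').symm),
      fun h => (left_inv a ha).symm.trans (h.trans (left_inv a' ha'))⟩
  congr' := congr'
  left_inv := left_inv
  right_inv b _ := by rw [right_inv]; exact refl b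

section Reroot

variable {G : Type*} [Group G] [TopologicalSpace G] [IsTopologicalGroup G]

theorem Config.smul_mem_smul {g a : G} {ω : Config G} : g * a ∈ g • ω ↔ a ∈ ω := by
  rw [Config.mem_smul, inv_mul_cancel_left]

theorem reroot_one (ω : Rooted G) (h : (1 : G) ∈ ω.1) : reroot ω.1 1 h = ω :=
  Rooted.ext' (by simp [reroot])

/-- Rerooting forgets the position in `G`. This makes every construction from root objects
equivariant on all configurations. -/
theorem reroot_smul {ω : Config G} {g a : G} (h : g * a ∈ g • ω) :
    reroot (g • ω) (g * a) h = reroot ω a (Config.smul_mem_smul.1 h) :=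
  Rooted.ext' (by simp [reroot, smul_smul, mul_assoc])

theorem rerootArrow_smul {ω : Config G} {g a b : G} (ha : g * a ∈ g • ω) (hb : g * b ∈ g • ω) :
    rerootArrow (g • ω) (g * a) (g * b) ha hb =
      rerootArrow ω a b (Config.smul_mem_smul.1 ha) (Config.smul_mem_smul.1 hb) :=
  Arrow.ext' (reroot_smul ha) (by simp [rerootArrow, mul_assoc])

theorem MarkedConfig.mem_smul {Ξ : Type*} [TopologicalSpace Ξ] {C : MarkedConfig G Ξ} {g a : G}
    {ξ : Ξ} : (a, ξ) ∈ (g • C).1 ↔ (g⁻¹ * a, ξ) ∈ C.1 := by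
  constructor
  · rintro ⟨⟨b, ζ⟩, h, e⟩
    obtain ⟨rfl, rfl⟩ := Prod.ext_iff.1 e
    have : g⁻¹ * (g * b) = b := inv_mul_cancel_left g b
    exact this.symm ▸ h
  · exact fun h => ⟨_, h, Prod.ext (mul_inv_cancel_left g a) rfl⟩

theorem GraphSpace.mem_smul {p : GraphSpace G} {g a b : G} :
    (a, b) ∈ (g • p).1.2 ↔ (g⁻¹ * a, g⁻¹ * b) ∈ p.1.2 := by
  constructor
  · rintro ⟨⟨c, d⟩, h, e⟩
    obtain ⟨rfl, rfl⟩ := Prod.ext_iff.1 e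
    have hc : g⁻¹ * (g * c) = c := inv_mul_cancel_left g c
    have hd : g⁻¹ * (g * d) = d := inv_mul_cancel_left g d
    change (g⁻¹ * (g * c), g⁻¹ * (g * d)) ∈ p.1.2
    rw [hc, hd]
    exact h
  · exact fun h => ⟨_, h, Prod.ext (mul_inv_cancel_left g a) (mul_inv_cancel_left g b)⟩

theorem IsFactorMap.ae {X : Type*} [MeasurableSpace G] [MeasurableSpace X] [SMul G X]
    {μ : Measure (Config G)} {R : Config G → X → Prop} {Φ : Config G → X}
    (h : IsFactorMap μ R Φ) : ∀ᵐ ω ∂μ, (∀ g : G, Φ (g • ω) = g • Φ ω) ∧ R ω (Φ ω) := by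
  obtain ⟨D, _, hD0, _, hD⟩ := h.exists_domain
  filter_upwards [show ∀ᵐ ω ∂μ, ω ∈ D from hD0] with ω hω using hD ω hω

theorem IsFactorMap.of_equivariant {X : Type*} [MeasurableSpace G] [MeasurableSpace X] [SMul G X]
    {μ : Measure (Config G)} {R : Config G → X → Prop} {Φ : Config G → X} (hm : Measurable Φ)
    (he : ∀ (g : G) ω, Φ (g • ω) = g • Φ ω) (hR : ∀ ω, R ω (Φ ω)) : IsFactorMap μ R Φ :=
  ⟨hm, univ, MeasurableSet.univ, by simp, fun _ _ _ => trivial,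
    fun ω _ => ⟨fun g => he g ω, hR ω⟩⟩

end Reroot

variable {G : Type*} [Group G] [TopologicalSpace G] [IsTopologicalGroup G]
  [LocallyCompactSpace G] [SecondCountableTopology G] [T2Space G] [MeasurableSpace G] [BorelSpace G]

/-! ### Factor thinnings -/

omit [LocallyCompactSpace G] [SecondCountableTopology G] [T2Space G] [MeasurableSpace G]
  [BorelSpace G] in
theorem unitSet_thinning (A : Set (Rooted G)) : unitSet (thinning A) = A := by
  ext η
  constructor
  · rintro ⟨h, hA⟩
    rwa [reroot_one] at hA
  · intro h
    refine ⟨η.2, ?_⟩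
    rwa [reroot_one]

omit [IsTopologicalGroup G] in
theorem measurableSet_unitSet {θ : Config G → Config G} (hθ : Measurable θ) :
    MeasurableSet (unitSet θ) :=
  measurableSet_mem_comp (hθ.comp measurable_subtype_coe) measurable_const

theorem isFactorThinning_thinning (μ : Measure (Config G)) {A : Set (Rooted G)}
    (hA : MeasurableSet A) : IsFactorThinning μ (thinning A) := by
  refine IsFactorMap.of_equivariant ?_ (fun g ω => SetLike.ext fun a => ?_) fun ω a h => h.1
  · refine Config.measurable_of_count fun U hU => ?_
    refine (congrArg Measurable (funext fun ω => ?_)).mp (measurable_rerootCount hU hA)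
    exact congrArg Set.encard (Set.ext fun g => And.comm)
  · obtain ⟨a, rfl⟩ : ∃ b, a = g * b := ⟨g⁻¹ * a, (mul_inv_cancel_left g a).symm⟩
    rw [Config.smul_mem_smul]
    constructor
    · rintro ⟨h, hA⟩
      exact ⟨Config.smul_mem_smul.1 h, reroot_smul h ▸ hA⟩
    · rintro ⟨h, hA⟩
      exact ⟨Config.smul_mem_smul.2 h, (reroot_smul (Config.smul_mem_smul.2 h)).symm ▸ hA⟩

omit [LocallyCompactSpace G] [SecondCountableTopology G] [T2Space G] [MeasurableSpace G]
  [BorelSpace G] in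
theorem thinning_eq_iff {A A' : Set (Rooted G)} {ω : Config G} :
    thinning A ω = thinning A' ω ↔ ∀ (g : G) (h : g ∈ ω), reroot ω g h ∈ A ↔ reroot ω g h ∈ A' := by
  rw [SetLike.ext_iff]
  refine forall_congr' fun g => ?_
  change ((∃ h : g ∈ ω, reroot ω g h ∈ A) ↔ ∃ h : g ∈ ω, reroot ω g h ∈ A') ↔ _
  exact ⟨fun h hg => ⟨fun hA => (h.1 ⟨hg, hA⟩).2, fun hA => (h.2 ⟨hg, hA⟩).2⟩,
    fun h => exists_congr h⟩

omit [LocallyCompactSpace G] [SecondCountableTopology G] [T2Space G] [BorelSpace G] in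
-- By equivariance, `1 ∈ θ (g⁻¹ • ω)` says exactly that `g ∈ θ ω`, simultaneously for all `g`,
-- whenever `ω` lies in the domain of the factor.
theorem thinning_unitSet {μ : Measure (Config G)} {θ : Config G → Config G}
    (hθ : IsFactorThinning μ θ) : thinning (unitSet θ) =ᵐ[μ] θ := by
  filter_upwards [hθ.ae] with ω hω
  have key : ∀ (g : G) (h : g ∈ ω), reroot ω g h ∈ unitSet θ ↔ g ∈ θ ω := fun g h => by
    change (1 : G) ∈ θ (g⁻¹ • ω) ↔ _
    rw [hω.1, Config.mem_smul]
    simp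
  refine SetLike.ext fun g => ⟨?_, fun h => ?_⟩
  · rintro ⟨h, hg⟩
    exact (key g h).1 hg
  · exact ⟨hω.2 h, (key g (hω.2 h)).2 h⟩

theorem isCorrespondence_thinning (haar : Measure G) [haar.IsHaarMeasure] (μ : Measure (Config G))
    [SFinite μ] [SMulInvariantMeasure G (Config G) μ] {U : Set G} (hU : MeasurableSet U)
    (hU0 : haar U ≠ 0) (hUtop : haar U ≠ ∞) (hpos : intensity haar μ U ≠ 0)
    (hfin : intensity haar μ U ≠ ∞) :
    IsCorrespondence
      (fun θ : Config G → Config G => IsFactorThinning μ θ) (fun θ θ' => θ =ᵐ[μ] θ')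
      (fun A : Set (Rooted G) => MeasurableSet A) (fun A A' => A =ᵐ[palmMeasure haar μ U hU] A')
      unitSet thinning := by
  refine IsCorrespondence.of_congr_inverse (fun θ hθ => measurableSet_unitSet hθ.measurable)
    (fun A hA => isFactorThinning_thinning μ hA) (fun A A' hA hA' => ?_)
    (fun θ hθ => thinning_unitSet hθ) unitSet_thinning fun A => Filter.EventuallyEq.refl _ _
  have hiff : MeasurableSet {η | η ∈ A ↔ η ∈ A'} := MeasurableSet.iff hA hA'
  rw [Filter.eventuallyEq_set, ae_palmMeasure_iff haar μ hU hU0 hUtop hpos hfin hiff]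
  exact Filter.eventually_congr (Filter.Eventually.of_forall fun ω => thinning_eq_iff.symm)

/-! ### Factor markings -/

section Marking

variable {Ξ : Type*} [TopologicalSpace Ξ]

omit [IsTopologicalGroup G] [LocallyCompactSpace G] [SecondCountableTopology G] [T2Space G]
  [MeasurableSpace G] [BorelSpace G] in
theorem rootMark_eq [Nonempty Ξ] {C : Config G → MarkedConfig G Ξ} {η : Rooted G} {ξ : Ξ}
    (h : ((1 : G), ξ) ∈ (C η.1).1) : rootMark C η = ξ := by
  have hex : ∃ ξ, ((1 : G), ξ) ∈ (C η.1).1 := ⟨ξ, h⟩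
  rw [rootMark, dif_pos hex]
  exact (C η.1).2 _ _ _ hex.choose_spec h

omit [IsTopologicalGroup G] [LocallyCompactSpace G] in
theorem measurable_rootMark [MeasurableSpace Ξ] [Nonempty Ξ] {C : Config G → MarkedConfig G Ξ}
    (hC : Measurable C) : Measurable (rootMark C) := by
  have hm : Measurable fun η : Rooted G => (C η.1).1 :=
    measurable_subtype_coe.comp (hC.comp measurable_subtype_coe)
  have hE : ∀ V : Set Ξ, MeasurableSet V →
      MeasurableSet {η : Rooted G | ∃ z ∈ (C η.1).1, z ∈ ({1} : Set G) ×ˢ V} := fun V hV =>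
    hm (Config.measurableSet_exists_mem ((measurableSet_singleton _).prod hV))
  intro V hV
  -- The second set collects the configurations with no mark at the root, where `rootMark` takes its
  -- default value.
  convert (hE V hV).union ((hE univ MeasurableSet.univ).compl.inter
    (MeasurableSet.const (Classical.arbitrary Ξ ∈ V))) using 1
  ext η
  constructor
  · intro h
    by_cases hex : ∃ ξ, ((1 : G), ξ) ∈ (C η.1).1
    · obtain ⟨ξ, hξ⟩ := hex
      rw [mem_preimage, rootMark_eq hξ] at h
      exact Or.inl ⟨_, hξ, rfl, h⟩
    · rw [mem_preimage, rootMark, dif_neg hex] at h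
      refine Or.inr ⟨?_, h⟩
      rintro ⟨⟨g, ξ⟩, hz, hg, _⟩
      obtain rfl : g = 1 := hg
      exact hex ⟨ξ, hz⟩
  · rintro (⟨⟨g, ξ⟩, hz, hg, hV⟩ | ⟨hno, h⟩)
    · obtain rfl : g = 1 := hg
      rw [mem_preimage, rootMark_eq hz]
      exact hV
    · rw [mem_preimage, rootMark, dif_neg]
      · exact h
      · rintro ⟨ξ, hξ⟩
        exact hno ⟨_, hξ, rfl, trivial⟩

omit [LocallyCompactSpace G] [SecondCountableTopology G] [T2Space G] [MeasurableSpace G]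
  [BorelSpace G] in
theorem mem_marking [T1Space Ξ] {P : Rooted G → Ξ} {ω : Config G} {g : G} {ξ : Ξ} :
    (g, ξ) ∈ (marking P ω).1 ↔ ∃ h : g ∈ ω, P (reroot ω g h) = ξ :=
  Iff.rfl

omit [LocallyCompactSpace G] [SecondCountableTopology G] [T2Space G] [MeasurableSpace G]
  [BorelSpace G] in
theorem rootMark_marking [T1Space Ξ] [Nonempty Ξ] (P : Rooted G → Ξ) : rootMark (marking P) = P := by
  ext η
  exact rootMark_eq (mem_marking.2 ⟨η.2, by rw [reroot_one]⟩)

omit [LocallyCompactSpace G] [SecondCountableTopology G] [T2Space G] [MeasurableSpace G]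
  [BorelSpace G] in
theorem marking_points [T1Space Ξ] (P : Rooted G → Ξ) (ω : Config G) :
    (marking P ω).points = (ω : Set G) :=
  Set.ext fun _ => ⟨fun ⟨_, h⟩ => h.1, fun h => ⟨_, mem_marking.2 ⟨h, rfl⟩⟩⟩

theorem measurable_marking [T1Space Ξ] [Nonempty Ξ] [MeasurableSpace Ξ] {P : Rooted G → Ξ}
    (hP : Measurable P) : Measurable (marking P) := by
  -- The extension `Q` makes `Q (g⁻¹ • ω)` meaningful and jointly measurable for all `g`. Counting
  -- marked points in `W` then becomes counting points `g` of `ω` with `(g, Q (g⁻¹ • ω)) ∈ W`.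
  obtain ⟨Q, hQ, hQP⟩ := measurableEmbedding_rooted.exists_measurable_extend hP fun _ => ‹_›
  have hQr : ∀ ω (g : G) (h : g ∈ ω), Q (g⁻¹ • ω) = P (reroot ω g h) := fun ω g h =>
    congrFun hQP (reroot ω g h)
  refine Measurable.subtype_mk (Config.measurable_of_count fun W hW => ?_)
  have hS : MeasurableSet {p : Config G × G | (p.2, Q (p.2⁻¹ • p.1)) ∈ W} :=
    (measurable_snd.prodMk (hQ.comp measurable_inv_smul)) hW
  refine (congrArg Measurable (funext fun ω => ?_)).mp (measurable_encard_points measurable_id hS)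
  have hinj : Injective fun g : G => (g, Q (g⁻¹ • ω)) := fun g h e => congrArg Prod.fst e
  rw [← hinj.encard_image]
  refine congrArg Set.encard (Set.ext fun p => ⟨?_, ?_⟩)
  · rintro ⟨g, ⟨hg, hgW⟩, rfl⟩
    exact ⟨⟨hg, (hQr ω g hg).symm⟩, hgW⟩
  · obtain ⟨g, ξ⟩ := p
    rintro ⟨⟨hg, e⟩, hgW⟩
    have e' : Q (g⁻¹ • ω) = ξ := (hQr ω g hg).trans e
    subst e'
    exact ⟨g, ⟨hg, hgW⟩, rfl⟩

theorem isFactorMarking_marking [T1Space Ξ] [Nonempty Ξ] [MeasurableSpace Ξ]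
    (μ : Measure (Config G)) {P : Rooted G → Ξ} (hP : Measurable P) :
    IsFactorMarking μ (marking P) := by
  refine IsFactorMap.of_equivariant (measurable_marking hP)
    (fun g ω => Subtype.ext (SetLike.ext fun ⟨a, ξ⟩ => ?_)) (marking_points P)
  obtain ⟨a, rfl⟩ : ∃ b, a = g * b := ⟨g⁻¹ * a, (mul_inv_cancel_left g a).symm⟩
  rw [MarkedConfig.mem_smul, inv_mul_cancel_left, mem_marking, mem_marking]
  constructor
  · rintro ⟨h, e⟩
    exact ⟨Config.smul_mem_smul.1 h, reroot_smul h ▸ e⟩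
  · rintro ⟨h, e⟩
    exact ⟨Config.smul_mem_smul.2 h, (reroot_smul (Config.smul_mem_smul.2 h)).symm ▸ e⟩

omit [LocallyCompactSpace G] [SecondCountableTopology G] [T2Space G] [MeasurableSpace G]
  [BorelSpace G] in
theorem marking_eq_iff [T1Space Ξ] {P P' : Rooted G → Ξ} {ω : Config G} :
    marking P ω = marking P' ω ↔
      ∀ (g : G) (h : g ∈ ω), P (reroot ω g h) = P' (reroot ω g h) := by
  constructor
  · intro e g h
    have : (g, P (reroot ω g h)) ∈ (marking P' ω).1 := e ▸ mem_marking.2 ⟨h, rfl⟩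
    exact (mem_marking.1 this).2.symm
  · refine fun e => Subtype.ext (SetLike.ext fun ⟨g, ξ⟩ => ?_)
    rw [mem_marking, mem_marking]
    exact exists_congr fun h => by rw [e]

omit [LocallyCompactSpace G] [SecondCountableTopology G] [T2Space G] [BorelSpace G] in
theorem marking_rootMark [T1Space Ξ] [Nonempty Ξ] [MeasurableSpace Ξ] {μ : Measure (Config G)}
    {C : Config G → MarkedConfig G Ξ} (hC : IsFactorMarking μ C) :
    marking (rootMark C) =ᵐ[μ] C := by
  filter_upwards [hC.ae] with ω hω
  have key : ∀ (g : G) (h : g ∈ ω) (ξ : Ξ), (g, ξ) ∈ (C ω).1 → rootMark C (reroot ω g h) = ξ := by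
    intro g h ξ hξ
    refine rootMark_eq ?_
    change ((1 : G), ξ) ∈ (C (g⁻¹ • ω)).1
    rw [hω.1, MarkedConfig.mem_smul]
    simpa using hξ
  refine Subtype.ext (SetLike.ext fun ⟨g, ξ⟩ => ?_)
  rw [mem_marking]
  constructor
  · rintro ⟨h, rfl⟩
    -- Every point of `ω` carries a mark, so the default value of `rootMark` plays no role here.
    obtain ⟨ζ, hζ⟩ : g ∈ (C ω).points := by rw [hω.2]; exact h
    rwa [key g h ζ hζ]
  · intro h
    have hg : g ∈ ω := by
      have : g ∈ (C ω).points := ⟨ξ, h⟩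
      rwa [hω.2] at this
    exact ⟨hg, key g hg ξ h⟩

theorem isCorrespondence_marking [PolishSpace Ξ] [MeasurableSpace Ξ] [BorelSpace Ξ] [Nonempty Ξ]
    (haar : Measure G) [haar.IsHaarMeasure] (μ : Measure (Config G))
    [SFinite μ] [SMulInvariantMeasure G (Config G) μ] {U : Set G} (hU : MeasurableSet U)
    (hU0 : haar U ≠ 0) (hUtop : haar U ≠ ∞) (hpos : intensity haar μ U ≠ 0)
    (hfin : intensity haar μ U ≠ ∞) :
    IsCorrespondence
      (fun C : Config G → MarkedConfig G Ξ => IsFactorMarking μ C) (fun C C' => C =ᵐ[μ] C')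
      (fun P : Rooted G → Ξ => Measurable P) (fun P P' => P =ᵐ[palmMeasure haar μ U hU] P')
      rootMark marking := by
  refine IsCorrespondence.of_congr_inverse (fun C hC => measurable_rootMark hC.measurable)
    (fun P hP => isFactorMarking_marking μ hP) (fun P P' hP hP' => ?_)
    (fun C hC => marking_rootMark hC) rootMark_marking fun P => Filter.EventuallyEq.refl _ _
  refine (ae_palmMeasure_iff haar μ hU hU0 hUtop hpos hfin (measurableSet_eq_fun hP hP')).trans ?_
  exact Filter.eventually_congr (Filter.Eventually.of_forall fun ω => marking_eq_iff.symm)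

end Marking

/-! ### Factor graphs -/

omit [Group G] [IsTopologicalGroup G] in
-- The number of pairs in `W` is an iterated sum over points of `ω`, that is, an iterated integral
-- against `pointKernel G`.
theorem measurable_completeEdges : Measurable (completeEdges (G := G)) := by
  refine Config.measurable_of_count fun W hW => measurable_of_toENNReal ?_
  have hf : Measurable fun p : Config G × G => ∫⁻ h, W.indicator 1 (p.2, h) ∂pointKernel G p.1 :=
    Measurable.lintegral_kernel_prod_right' (κ := (pointKernel G).comap Prod.fst measurable_fst)
      (f := fun q : (Config G × G) × G => W.indicator 1 (q.1.2, q.2))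
      ((measurable_one.indicator hW).comp (measurable_fst.snd.prodMk measurable_snd))
  refine (congrArg Measurable (funext fun ω => ?_)).mp
    (Measurable.lintegral_kernel_prod_right' (κ := pointKernel G) hf)
  have h := lintegral_pointKernel_indicator (completeEdges ω) hW
  rw [lintegral_pointKernel] at h
  refine Eq.trans ?_ h
  rw [lintegral_pointKernel]
  simp_rw [lintegral_pointKernel]
  rw [← ENNReal.tsum_prod (f := fun (g h : ω) => W.indicator (1 : G × G → ℝ≥0∞) (g.1, h.1))]
  exact ((Equiv.Set.prod (ω : Set G) (ω : Set G)).tsum_eq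
    fun p => W.indicator (1 : G × G → ℝ≥0∞) (p.1.1, p.2.1)).symm

omit [LocallyCompactSpace G] [SecondCountableTopology G] [T2Space G] [MeasurableSpace G]
  [BorelSpace G] in
theorem mem_factorGraph {𝒜 : Set (Arrow G)} {ω : Config G} {g h : G} :
    (g, h) ∈ (factorGraph 𝒜 ω).1.2 ↔
      ∃ (hg : g ∈ ω) (hh : h ∈ ω), rerootArrow ω g h hg hh ∈ 𝒜 :=
  Iff.rfl

/-- The edge set is selected from the complete graph by a Borel condition on the pair `(ω, edge)`,
so its counts are measurable once `completeEdges` is. -/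
theorem measurable_factorGraph {𝒜 : Set (Arrow G)} (h𝒜 : MeasurableSet 𝒜) :
    Measurable (factorGraph 𝒜) := by
  refine Measurable.subtype_mk (measurable_id.prodMk (Config.measurable_of_count fun W hW => ?_))
  have hT := measurableEmbedding_arrow.measurableSet_image.2 h𝒜
  have hS : MeasurableSet ({q : Config G × (G × G) | q.2 ∈ W} ∩
      {q | (q.2.1⁻¹ • q.1, q.2.1⁻¹ * q.2.2) ∈
        (fun a : Arrow G => ((a.1.1.1, a.1.2) : Config G × G)) '' 𝒜}) :=
    (measurable_snd hW).inter (((measurable_inv_smul.comp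
      (measurable_fst.prodMk measurable_snd.fst)).prodMk
        (measurable_snd.fst.inv.mul measurable_snd.snd)) hT)
  refine (congrArg Measurable (funext fun ω => ?_)).mp
    (measurable_encard_points measurable_completeEdges hS)
  refine congrArg Set.encard (Set.ext fun p => ⟨?_, ?_⟩)
  · rintro ⟨⟨hg, hh⟩, hW, hp⟩
    exact ⟨⟨hg, hh, (measurableEmbedding_arrow.injective.mem_set_image
      (a := rerootArrow ω p.1 p.2 hg hh)).1 hp⟩, hW⟩
  · rintro ⟨⟨hg, hh, hp⟩, hW⟩
    exact ⟨⟨hg, hh⟩, hW, _, hp, rfl⟩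

theorem isFactorGraph_factorGraph (μ : Measure (Config G)) {𝒜 : Set (Arrow G)}
    (h𝒜 : MeasurableSet 𝒜) : IsFactorGraph μ (factorGraph 𝒜) := by
  refine IsFactorMap.of_equivariant (measurable_factorGraph h𝒜)
    (fun g ω => Subtype.ext (Prod.ext rfl (SetLike.ext fun ⟨a, b⟩ => ?_))) fun ω => rfl
  obtain ⟨a, rfl⟩ : ∃ c, a = g * c := ⟨g⁻¹ * a, (mul_inv_cancel_left g a).symm⟩
  obtain ⟨b, rfl⟩ : ∃ c, b = g * c := ⟨g⁻¹ * b, (mul_inv_cancel_left g b).symm⟩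
  rw [GraphSpace.mem_smul, inv_mul_cancel_left, inv_mul_cancel_left, mem_factorGraph,
    mem_factorGraph]
  constructor
  · rintro ⟨ha, hb, h⟩
    exact ⟨Config.smul_mem_smul.1 ha, Config.smul_mem_smul.1 hb, rerootArrow_smul ha hb ▸ h⟩
  · rintro ⟨ha, hb, h⟩
    exact ⟨Config.smul_mem_smul.2 ha, Config.smul_mem_smul.2 hb,
      (rerootArrow_smul (Config.smul_mem_smul.2 ha) (Config.smul_mem_smul.2 hb)).symm ▸ h⟩

omit [LocallyCompactSpace G] [SecondCountableTopology G] [T2Space G] [MeasurableSpace G]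
  [BorelSpace G] in
theorem rerootArrow_one (a : Arrow G) (h1 : (1 : G) ∈ a.1.1.1) (h2 : a.1.2 ∈ a.1.1.1) :
    rerootArrow a.1.1.1 1 a.1.2 h1 h2 = a :=
  Arrow.ext' (reroot_one a.1.1 h1) (by simp [rerootArrow])

omit [LocallyCompactSpace G] [SecondCountableTopology G] [T2Space G] [MeasurableSpace G]
  [BorelSpace G] in
theorem arrowSet_factorGraph (𝒜 : Set (Arrow G)) : arrowSet (factorGraph 𝒜) = 𝒜 := by
  ext a
  constructor
  · rintro ⟨h1, h2, h⟩
    rwa [rerootArrow_one] at h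
  · intro h
    refine ⟨a.1.1.2, a.2, ?_⟩
    rwa [rerootArrow_one]

omit [IsTopologicalGroup G] in
theorem measurableSet_arrowSet {Γ : Config G → GraphSpace G} (hΓ : Measurable Γ) :
    MeasurableSet (arrowSet Γ) := by
  refine measurableSet_mem_comp (Z := G × G) ?_ ?_
  · exact (measurable_snd.comp measurable_subtype_coe).comp (hΓ.comp
      (measurable_subtype_coe.comp (measurable_fst.comp measurable_subtype_coe)))
  · exact measurable_const.prodMk (measurable_snd.comp measurable_subtype_coe)

omit [LocallyCompactSpace G] [SecondCountableTopology G] [T2Space G] [MeasurableSpace G]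
  [BorelSpace G] in
-- The substitution `h = g * k` turns pairs of points of `ω` into arrows leaving its rerootings, the
-- form produced by combining `ae_sourceMeasure_iff` with `ae_palmMeasure_iff`.
theorem factorGraph_eq_iff {𝒜 𝒜' : Set (Arrow G)} {ω : Config G} :
    factorGraph 𝒜 ω = factorGraph 𝒜' ω ↔ ∀ (g : G) (hg : g ∈ ω) (k : G)
      (hk : k ∈ (reroot ω g hg).1), ((⟨(reroot ω g hg, k), hk⟩ : Arrow G) ∈ 𝒜 ↔
        (⟨(reroot ω g hg, k), hk⟩ : Arrow G) ∈ 𝒜') := by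
  have h1 : factorGraph 𝒜 ω = factorGraph 𝒜' ω ↔ ∀ (g h : G) (hg : g ∈ ω) (hh : h ∈ ω),
      rerootArrow ω g h hg hh ∈ 𝒜 ↔ rerootArrow ω g h hg hh ∈ 𝒜' := by
    constructor
    · intro e g h hg hh
      have : (g, h) ∈ (factorGraph 𝒜 ω).1.2 ↔ (g, h) ∈ (factorGraph 𝒜' ω).1.2 := by rw [e]
      rw [mem_factorGraph, mem_factorGraph] at this
      exact ⟨fun hA => (this.1 ⟨hg, hh, hA⟩).2.2, fun hA => (this.2 ⟨hg, hh, hA⟩).2.2⟩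
    · refine fun e => Subtype.ext (Prod.ext rfl (SetLike.ext fun ⟨g, h⟩ => ?_))
      exact exists_congr fun hg => exists_congr fun hh => e g h hg hh
  rw [h1]
  constructor
  · intro e g hg k hk
    have hgk : g * k ∈ ω := by
      change k ∈ g⁻¹ • ω at hk
      rwa [Config.mem_smul, inv_inv] at hk
    have : rerootArrow ω g (g * k) hg hgk = ⟨(reroot ω g hg, k), hk⟩ :=
      Arrow.ext' rfl (inv_mul_cancel_left g k)
    rw [← this]
    exact e _ _ _ _
  · exact fun e g h hg hh => e g hg (g⁻¹ * h) (rerootArrow ω g h hg hh).2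

omit [LocallyCompactSpace G] [SecondCountableTopology G] [T2Space G] [BorelSpace G] in
theorem factorGraph_arrowSet {μ : Measure (Config G)} {Γ : Config G → GraphSpace G}
    (hΓ : IsFactorGraph μ Γ) : factorGraph (arrowSet Γ) =ᵐ[μ] Γ := by
  filter_upwards [hΓ.ae] with ω hω
  have key : ∀ (g h : G) (hg : g ∈ ω) (hh : h ∈ ω),
      rerootArrow ω g h hg hh ∈ arrowSet Γ ↔ (g, h) ∈ (Γ ω).1.2 := fun g h hg hh => by
    change ((1 : G), g⁻¹ * h) ∈ (Γ (g⁻¹ • ω)).1.2 ↔ _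
    rw [hω.1, GraphSpace.mem_smul]
    simp
  refine Subtype.ext (Prod.ext hω.2.symm (SetLike.ext fun ⟨g, h⟩ => ?_))
  rw [mem_factorGraph]
  constructor
  · rintro ⟨hg, hh, H⟩
    exact (key g h hg hh).1 H
  · intro H
    have := (Γ ω).2 H
    rw [hω.2] at this
    exact ⟨this.1, this.2, (key g h this.1 this.2).2 H⟩

theorem measurableSet_forall_source_fiber {p : Arrow G → Prop} (hp : MeasurableSet {a | p a}) :
    MeasurableSet {η : Rooted G | ∀ (k : G) (hk : k ∈ η.1), p ⟨(η, k), hk⟩} := by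
  convert measurable_source_fiber hp.compl (measurableSet_singleton (0 : ℕ∞)) using 1
  ext η
  simp only [mem_preimage, mem_singleton_iff, encard_eq_zero, eq_empty_iff_forall_notMem]
  constructor
  · rintro h a ⟨rfl, ha⟩
    exact ha (h _ a.2)
  · exact fun h k hk => by_contra fun hn => h ⟨(η, k), hk⟩ ⟨rfl, hn⟩

theorem isCorrespondence_factorGraph (haar : Measure G) [haar.IsHaarMeasure]
    (μ : Measure (Config G)) [SFinite μ] [SMulInvariantMeasure G (Config G) μ] {U : Set G}
    (hU : MeasurableSet U) (hU0 : haar U ≠ 0) (hUtop : haar U ≠ ∞)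
    (hpos : intensity haar μ U ≠ 0) (hfin : intensity haar μ U ≠ ∞) :
    IsCorrespondence
      (fun Γ : Config G → GraphSpace G => IsFactorGraph μ Γ) (fun Γ Γ' => Γ =ᵐ[μ] Γ')
      (fun 𝒜 : Set (Arrow G) => MeasurableSet 𝒜)
      (fun 𝒜 𝒜' => 𝒜 =ᵐ[sourceMeasure (palmMeasure haar μ U hU)] 𝒜')
      arrowSet factorGraph := by
  refine IsCorrespondence.of_congr_inverse (fun Γ hΓ => measurableSet_arrowSet hΓ.measurable)
    (fun 𝒜 h𝒜 => isFactorGraph_factorGraph μ h𝒜) (fun 𝒜 𝒜' h h' => ?_)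
    (fun Γ hΓ => factorGraph_arrowSet hΓ) arrowSet_factorGraph
    fun 𝒜 => Filter.EventuallyEq.refl _ _
  have hiff : MeasurableSet {a | a ∈ 𝒜 ↔ a ∈ 𝒜'} := MeasurableSet.iff h h'
  -- Null sets are transferred twice: from arrows to all arrows leaving almost every unit, then from
  -- units to all points of almost every `ω`.
  rw [Filter.eventuallyEq_set, ae_sourceMeasure_iff _ hiff,
    ae_palmMeasure_iff haar μ hU hU0 hUtop hpos hfin (measurableSet_forall_source_fiber hiff)]
  exact Filter.eventually_congr (Filter.Eventually.of_forall fun ω => factorGraph_eq_iff.symm)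

end

end PointProcess

theorem mainTheorem3 {G : Type*} [Group G] [TopologicalSpace G] [IsTopologicalGroup G]
    [LocallyCompactSpace G] [SecondCountableTopology G] [T2Space G] [MeasurableSpace G]
    [BorelSpace G] (haar : Measure G) [haar.IsHaarMeasure]
    (μ : Measure (Config G)) [IsProbabilityMeasure μ] [SMulInvariantMeasure G (Config G) μ]
    (U : Set G) (hU : MeasurableSet U) (hU0 : haar U ≠ 0) (hUtop : haar U ≠ ∞)
    (hpos : intensity haar μ U ≠ 0) (hfin : intensity haar μ U ≠ ∞)
    {Ξ : Type*} [TopologicalSpace Ξ] [PolishSpace Ξ] [MeasurableSpace Ξ] [BorelSpace Ξ]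
    [Nonempty Ξ] :
    -- the intensity and the Palm measure do not depend on `U`
    (∀ (V : Set G) (hV : MeasurableSet V), haar V ≠ 0 → haar V ≠ ∞ →
      intensity haar μ V = intensity haar μ U ∧
        palmMeasure haar μ V hV = palmMeasure haar μ U hU) ∧
    -- the rerooting groupoid with the Palm measure is `r`-discrete, and pmp if `G` is unimodular
    (rerootingGroupoid G).IsRDiscrete ∧
    IsProbabilityMeasure (palmMeasure haar μ U hU) ∧
    (haar.IsMulRightInvariant →
      sourceMeasure (palmMeasure haar μ U hU) = targetMeasure (palmMeasure haar μ U hU)) ∧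
    -- factor thinnings and Borel subsets of the unit space
    IsCorrespondence
      (fun θ : Config G → Config G => IsFactorThinning μ θ)
      (fun θ θ' => θ =ᵐ[μ] θ')
      (fun A : Set (Rooted G) => MeasurableSet A)
      (fun A A' => A =ᵐ[palmMeasure haar μ U hU] A')
      unitSet thinning ∧
    -- factor `Ξ`-markings and Borel maps from the unit space to `Ξ`
    IsCorrespondence
      (fun C : Config G → MarkedConfig G Ξ => IsFactorMarking μ C)
      (fun C C' => C =ᵐ[μ] C')
      (fun P : Rooted G → Ξ => Measurable P)
      (fun P P' => P =ᵐ[palmMeasure haar μ U hU] P')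
      rootMark marking ∧
    -- factor graphs and Borel subsets of the arrow space
    IsCorrespondence
      (fun Γ : Config G → GraphSpace G => IsFactorGraph μ Γ)
      (fun Γ Γ' => Γ =ᵐ[μ] Γ')
      (fun 𝒜 : Set (Arrow G) => MeasurableSet 𝒜)
      (fun 𝒜 𝒜' => 𝒜 =ᵐ[sourceMeasure (palmMeasure haar μ U hU)] 𝒜')
      arrowSet factorGraph := by
  exact ⟨fun V hV hV0 hVtop =>
      intensity_palmMeasure_eq haar μ hU hU0 hUtop hfin hV hV0 hVtop,
    rerootingGroupoid_isRDiscrete G,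
    isProbabilityMeasure_palmMeasure haar μ hU hpos hfin,
    fun _ => sourceMeasure_eq_targetMeasure haar μ hU hU0 hUtop hpos hfin,
    isCorrespondence_thinning haar μ hU hU0 hUtop hpos hfin,
    isCorrespondence_marking haar μ hU hU0 hUtop hpos hfin,
    isCorrespondence_factorGraph haar μ hU hU0 hUtop hpos hfin⟩
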